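/- Let $\mathbb K\in\{\mathbb R,\mathbb C\}$. A *graded manifold* $\mathcal M$ is a (Hausdorff, second countable) smooth manifold $M$ with a sheaf of $\mathbb Z$-graded commutative $\mathbb K$-algebras that is locally isomorphic to $C^\infty(U,\mathbb K)\otimes\widehat S(W^\vee)$ for a fixed finite-dimensional graded vector space $W$, where $\widehat S(W^\vee)$ denotes formal power series on $W$. Let $C^\infty_{\mathcal M}$ be the algebra of global sections, and let $\mathcal X(\mathcal M)$ be the space of vector fields, that is, of graded derivations of $C^\infty_{\mathcal M}$. A *dg manifold* is a graded manifold with a vector field $Q$ of degree $1$ such that $Q^2=0$. Let $(\mathcal M,Q)$ be a dg manifold. The degree of a homogeneous $f\in C^\infty_{\mathcal M}$, $X\in\mathcal X(\mathcal M)$ or differential operator $D$ is written $\tilde f$, $\tilde X$, $\tilde D$. Spaces of graded objects are direct sums of their homogeneous parts. *Polydifferential operators.* Let $\mathcal D_{\mathcal M}$ be the algebra of differential operators on $\mathcal M$, i.e. the graded subalgebra of $\mathrm{End}_{\mathbb K}(C^\infty_{\mathcal M})$ generated by functions and vector fields. Put $\mathcal D^0_{\rm poly}=C^\infty_{\mathcal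 M}$, $\mathcal D^1_{\rm poly}=\mathcal D_{\mathcal M}$, and for $n\ge 1$ let $\mathcal D^n_{\rm poly}$ be the space of operators $(f_1,\dots,f_n)\mapsto F(f_1,\dots,f_n)$ spanned by $$(f_1,\dots,f_n)\mapsto(-1)^{\sum_{i<j}(\tilde f_i+1)(\tilde D_j+1)}D_1(f_1)\cdots D_n(f_n),\qquad D_i\in\mathcal D_{\mathcal M}.$$ An element of $\mathcal D^n_{\rm poly}$ of vertical degree $q$ (i.e. raising the degree by $q$) has total degree $|F|=n+q$; $\mathrm{tot}\,\mathcal D_{\rm poly}$ is the direct sum of all these components, graded by total degree. For $D\in\mathcal D^1_{\rm poly}$ and $X\in\mathcal X(\mathcal M)$ let $\overline D,\overline X\in\mathrm{tot}\,\mathcal D_{\rm poly}$ be the corresponding elements, so $|\overline D|=\tilde D+1$ and $|\overline X|=\tilde X+1$; $\overline X$ also denotes the element of $\mathcal X(\mathcal M)[-1]$ corresponding to $X$. For $F$ with $n$ arguments and $G$ with $m$ arguments put $$(F\cup G)(f_1,\dots,f_{n+m})=(-1)^{|G|(\tilde f_1+\cdots+\tilde f_n+n)}F(f_1,\dots,f_n)\,G(f_{n+1},\dots,f_{n+m}),$$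 $$(F\circ G)(f_1,\dots,f_{n+m-1})=\sum_{j=0}^{n-1}(-1)^{(|G|+1)(\tilde f_1+\cdots+\tilde f_j+j)}F(f_1,\dots,f_j,G(f_{j+1},\dots,f_{j+m}),f_{j+m+1},\dots,f_{n+m-1}),$$ $$[F,G]=F\circ G-(-1)^{(|F|+1)(|G|+1)}G\circ F,\qquad [\![F,G]\!]=F\cup G-(-1)^{|F||G|}G\cup F.$$ Let $m(f_1,f_2)=(-1)^{\tilde f_1}f_1f_2$, $L_Q=[Q,\cdot]$ and $d_H=[m,\cdot]$ (the Hochschild differential), and give $\mathrm{tot}\,\mathcal D_{\rm poly}$ the differential $L_Q+d_H$. The *canonical connection* is $\nabla^{\rm can}_XF=X\circ F$ for $X\in\mathcal X(\mathcal M)$, $F\in\mathrm{tot}\,\mathcal D_{\rm poly}$. *Atiyah cocycle.* For a module $\mathcal E$ with differential $d$ and a connection $\nabla$ of $\mathcal X(\mathcal M)$ on $\mathcal E$, the Atiyah cocycle is, for homogeneous $X$, $$\alpha^\nabla_{\mathcal E}(\overline X,\xi)=(-1)^{\tilde X}\bigl(d\,\nabla_X\xi-\nabla_{[Q,X]}\xi-(-1)^{\tilde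 X}\nabla_X\,d\xi\bigr).$$ *Claim.* (1) The Atiyah cocycle of $(\mathrm{tot}\,\mathcal D_{\rm poly},L_Q+d_H)$ with respect to $\nabla^{\rm can}$ is $$\alpha^{\nabla^{\rm can}}_{\mathcal D_{\rm poly}}(\overline X,\overline{D_1}\cup\cdots\cup\overline{D_n})=[\![\overline X,\overline{D_1}\cup\cdots\cup\overline{D_n}]\!]$$ for all $n\ge 0$, $X\in\mathcal X(\mathcal M)$ and $D_1,\dots,D_n\in\mathcal D^1_{\rm poly}$. (2) Let $\mathrm{tot}\,L(\mathcal D^1_{\rm poly})\subseteq\mathrm{tot}\,\mathcal D_{\rm poly}$ be the free Lie algebra on $\mathcal D^1_{\rm poly}$, i.e. the smallest subspace that contains all $\overline D$, $D\in\mathcal D^1_{\rm poly}$, and is closed under $[\![\cdot,\cdot]\!]$. It is stable under $L_Q+d_H$ and under all $\nabla^{\rm can}_X$, and the Atiyah cocycle of $(\mathrm{tot}\,L(\mathcal D^1_{\rm poly}),L_Q+d_H)$ with respect to the restricted connection is $$\alpha^{\nabla^{\rm can}}_{L(\mathcal D^1_{\rm poly})}\bigl(\overline X,[\![\overline{D_1},\cdots[\![\overline{D_{n-1}},\overline{D_n}]\!]\cdots]\!]\bigr)=[\![\overline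 X,[\![\overline{D_1},\cdots[\![\overline{D_{n-1}},\overline{D_n}]\!]\cdots]\!]]\!]$$ for all $n\ge 1$, $X\in\mathcal X(\mathcal M)$ and $D_1,\dots,D_n\in\mathcal D^1_{\rm poly}$. -/

import Mathlib

open DirectSum TopologicalSpace
open scoped Manifold ContDiff

universe u v w

/-! ## Vector fields and differential operators of a graded algebra -/

section Algebra

variable {𝕜 : Type u} [Field 𝕜] {A : Type v} [Ring A] [Algebra 𝕜 A]
variable (𝒜 : ℤ → Submodule 𝕜 A)

/-- The degree `k` part of the space of vector fields `Der(A)`: the `𝕜`-linear maps `X` of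
degree `k` with `X(ab) = X(a) b + (-1)^{k|a|} a X(b)` for homogeneous `a`. -/
def VField (k : ℤ) : Submodule 𝕜 (Module.End 𝕜 A) where
  carrier := {X | (∀ i, ∀ a ∈ 𝒜 i, X a ∈ 𝒜 (i + k)) ∧
    ∀ i, ∀ a ∈ 𝒜 i, ∀ b, X (a * b) = X a * b + (k * i).negOnePow • (a * X b)}
  add_mem' := by
    rintro X Y ⟨hX, hX'⟩ ⟨hY, hY'⟩
    refine ⟨fun i a ha => add_mem (hX i a ha) (hY i a ha), fun i a ha b => ?_⟩
    simp only [LinearMap.add_apply, hX' i a ha, hY' i a ha, mul_add, add_mul, smul_add]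
    abel
  zero_mem' := ⟨fun i a _ => by simp, fun i a _ b => by simp⟩
  smul_mem' := by
    rintro c X ⟨hX, hX'⟩
    refine ⟨fun i a ha => Submodule.smul_mem _ c (hX i a ha), fun i a ha b => ?_⟩
    simp only [LinearMap.smul_apply, hX' i a ha, smul_add, smul_mul_assoc, mul_smul_comm]
    rw [smul_comm]

variable {𝒜} in
theorem VField.bracket_mem {k : ℤ} {Q X : Module.End 𝕜 A} (hQ : Q ∈ VField 𝒜 1)
    (hX : X ∈ VField 𝒜 k) : Q * X - k.negOnePow • (X * Q) ∈ VField 𝒜 (k + 1) := by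
  refine ⟨fun i a ha => ?_, fun i a ha b => ?_⟩
  · have h1 := hQ.1 _ _ (hX.1 _ _ ha)
    have h2 := hX.1 _ _ (hQ.1 _ _ ha)
    rw [add_assoc] at h1
    rw [add_assoc, add_comm 1 k] at h2
    simp only [LinearMap.sub_apply, Units.smul_def, LinearMap.smul_apply]
    exact sub_mem h1 (zsmul_mem h2 _)
  · have h1 := hX.1 _ _ ha
    have h2 := hQ.1 _ _ ha
    simp only [LinearMap.sub_apply, Units.smul_def, LinearMap.smul_apply, Module.End.mul_apply,
      hX.2 i a ha, hQ.2 i a ha, map_add, map_zsmul, hX.2 _ _ h2, hQ.2 _ _ h1]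
    rw [show (1 : ℤ) * (i + k) = i + k by ring, show (1 : ℤ) * i = i by ring,
      show k * (i + 1) = k * i + k by ring, show (k + 1) * i = k * i + i by ring]
    simp only [Int.negOnePow_add]
    rcases Int.units_eq_one_or k.negOnePow with h | h <;>
    rcases Int.units_eq_one_or i.negOnePow with h' | h' <;>
    rcases Int.units_eq_one_or (k * i).negOnePow with h'' | h'' <;>
    · simp only [h, h', h'']
      simp [sub_mul, mul_sub, mul_add, add_mul]
      try abel

/-- `IsDiffOp 𝒜 d D`: `D` is a homogeneous differential operator of degree `d`. The differential
operators form the smallest graded subalgebra of `End(A)` that contains the multiplications by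
functions and the vector fields. -/
inductive IsDiffOp : ℤ → Module.End 𝕜 A → Prop
  | mul {i : ℤ} {a : A} (ha : a ∈ 𝒜 i) : IsDiffOp i (LinearMap.mulLeft 𝕜 a)
  | field {k : ℤ} {X : Module.End 𝕜 A} (hX : X ∈ VField 𝒜 k) : IsDiffOp k X
  | comp {d e : ℤ} {D E : Module.End 𝕜 A} (hD : IsDiffOp d D) (hE : IsDiffOp e E) :
      IsDiffOp (d + e) (D * E)
  | add {d : ℤ} {D E : Module.End 𝕜 A} (hD : IsDiffOp d D) (hE : IsDiffOp d E) :
      IsDiffOp d (D + E)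

/-- The differential operators of degree `d`. -/
def DiffOp [GradedAlgebra 𝒜] (d : ℤ) : Submodule 𝕜 (Module.End 𝕜 A) where
  carrier := {D | IsDiffOp 𝒜 d D}
  add_mem' := IsDiffOp.add
  zero_mem' := by
    have h := IsDiffOp.mul (𝒜 := 𝒜) (i := d) (zero_mem _)
    rwa [LinearMap.mulLeft_zero_eq_zero] at h
  smul_mem' := by
    intro c D hD
    have h := IsDiffOp.comp (IsDiffOp.mul (𝒜 := 𝒜)
      (SetLike.algebraMap_mem_graded 𝒜 c)) hD
    rw [zero_add] at h
    have hc : c • D = LinearMap.mulLeft 𝕜 (algebraMap 𝕜 A c) * D := by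
      ext a
      simp [Algebra.smul_def]
    change IsDiffOp 𝒜 d (c • D)
    rwa [hc]

/-! ## Signs -/

variable [GradedAlgebra 𝒜]

/-- The linear map `a ↦ (-1)^{k|a|} a` for homogeneous `a`. -/
def sgn (k : ℤ) : A →ₗ[𝕜] A :=
  (DirectSum.toModule 𝕜 ℤ A fun i => ((k * i).negOnePow : ℤ) • (𝒜 i).subtype) ∘ₗ
    (DirectSum.decomposeLinearEquiv 𝒜).toLinearMap

/-- The linear map `a ↦ (-1)^{e(|a| + 1)} a` for homogeneous `a`. -/
def koszul (e : ℤ) : A →ₗ[𝕜] A := (e.negOnePow : ℤ) • sgn 𝒜 e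

/-! ## Operations on cochains -/

/-- Functions of `n` arguments in `A`. -/
abbrev Coch (A : Type v) (n : ℕ) : Type v := (Fin n → A) → A

/-- An operator seen as a cochain with one argument. -/
def coch (D : Module.End 𝕜 A) : Coch A 1 := fun f => D (f 0)

/-- The cup product
`(F ∪ G)(f₁,…,f_{p+q}) = (-1)^{e(|f₁|+⋯+|f_p|+p)} F(f₁,…,f_p) G(f_{p+1},…,f_{p+q})`,
where `e` is the total degree of `G`. -/
def cup {p q l : ℕ} (h : p + q = l) (e : ℤ) (F : Coch A p) (G : Coch A q) : Coch A l := fun f =>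
  F (fun i => koszul 𝒜 e (f ⟨i, by omega⟩)) * G (fun j => f ⟨p + j, by omega⟩)

/-- The Gerstenhaber product `F ∘ G`, equal to
`∑ⱼ (-1)^{(e+1)(|f₁|+⋯+|fⱼ|+j)} F(f₁,…,fⱼ,G(f_{j+1},…,f_{j+m}),f_{j+m+1},…)`,
where `e` is the total degree of `G`. -/
def gerst {n m l : ℕ} (h : l + 1 = n + m) (e : ℤ) (F : Coch A n) (G : Coch A m) : Coch A l :=
  fun f => ∑ j : Fin n, F fun i =>
    if hij : i < j then koszul 𝒜 (e + 1) (f ⟨i, by omega⟩)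
    else if hji : i = j then G fun k => f ⟨j + k, by omega⟩
    else f ⟨i + m - 1, by omega⟩

/-- The Gerstenhaber bracket `[F, G] = F ∘ G - (-1)^{(|F|+1)(|G|+1)} G ∘ F` of cochains of total
degrees `d` and `e`. -/
def gBracket {n m l : ℕ} (h : l + 1 = n + m) (d e : ℤ) (F : Coch A n) (G : Coch A m) : Coch A l :=
  gerst 𝒜 h e F G - ((d + 1) * (e + 1)).negOnePow •
    gerst 𝒜 (h.trans (Nat.add_comm n m)) d G F

/-- The multiplication cochain `m(f₁, f₂) = (-1)^{|f₁|} f₁ f₂`, of total degree `2`. -/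
def mulCoch : Coch A 2 := fun f => sgn 𝒜 1 (f 0) * f 1

/-! ## Polydifferential operators -/

/-- The space `D_poly^{n,q}` of `n`-polydifferential operators of vertical degree `q`, as operators
of `n` arguments: functions for `n = 0`, and spanned by the `D ∪ G` with `D` a differential
operator and `G` an `n`-polydifferential operator for `n + 1`. So it is spanned by the
`D₁ ∪ ⋯ ∪ Dₙ`, that is, by the operators
`(f₁,…,fₙ) ↦ (-1)^{∑_{i<j} (|f_i|+1)|D_j|} D₁(f₁) ⋯ Dₙ(fₙ)`, for `n ≥ 1`. -/
def Dpoly : (n : ℕ) → ℤ → Submodule 𝕜 (Coch A n)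
  | 0, q => (𝒜 q).comap (LinearMap.proj default)
  | n + 1, q => Submodule.span 𝕜 {F | ∃ d e : ℤ, d + e = q ∧ ∃ D ∈ DiffOp 𝒜 d, ∃ G ∈ Dpoly n e,
      F = cup 𝒜 (Nat.add_comm 1 n) (n + e) (coch D) G}

/-! ### Elementary facts on signs -/

variable {𝒜}

theorem sgn_of_mem (k : ℤ) {i : ℤ} {a : A} (ha : a ∈ 𝒜 i) :
    sgn 𝒜 k a = (k * i).negOnePow • a := by
  have h : DirectSum.decomposeLinearEquiv 𝒜 a = DirectSum.lof 𝕜 ℤ (fun i => 𝒜 i) i ⟨a, ha⟩ := by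
    exact DirectSum.decompose_of_mem 𝒜 ha
  simp only [sgn, LinearMap.comp_apply, LinearEquiv.coe_coe]
  rw [h, DirectSum.toModule_lof]
  simp [Units.smul_def]

theorem koszul_of_mem (e : ℤ) {i : ℤ} {a : A} (ha : a ∈ 𝒜 i) :
    koszul 𝒜 e a = (e * (i + 1)).negOnePow • a := by
  simp only [koszul, LinearMap.smul_apply, sgn_of_mem e ha]
  rw [mul_add, mul_one, add_comm, Int.negOnePow_add, mul_smul]
  simp [Units.smul_def]

theorem ext_homogeneous {N : Type*} [AddCommGroup N] [Module 𝕜 N] {S T : A →ₗ[𝕜] N}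
    (h : ∀ i, ∀ a ∈ 𝒜 i, S a = T a) (a : A) : S a = T a := by
  induction a using DirectSum.Decomposition.inductionOn 𝒜 with
  | zero => simp
  | homogeneous a => exact h _ a a.2
  | add a b ha hb => simp [ha, hb]

theorem koszul_koszul (d e : ℤ) (a : A) : koszul 𝒜 d (koszul 𝒜 e a) = koszul 𝒜 (d + e) a := by
  refine ext_homogeneous (𝒜 := 𝒜) (S := koszul 𝒜 d ∘ₗ koszul 𝒜 e) (T := koszul 𝒜 (d + e)) ?_ a
  intro i a ha
  have h : (e * (i + 1)).negOnePow • a ∈ 𝒜 i := by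
    rw [Units.smul_def]; exact zsmul_mem ha _
  simp only [LinearMap.comp_apply, koszul_of_mem _ ha, koszul_of_mem _ h]
  rw [smul_smul, ← Int.negOnePow_add, add_mul]

theorem koszul_add_two (e : ℤ) (a : A) : koszul 𝒜 (e + 2) a = koszul 𝒜 e a := by
  refine ext_homogeneous (𝒜 := 𝒜) ?_ a
  intro i a ha
  rw [koszul_of_mem _ ha, koszul_of_mem _ ha, add_mul, Int.negOnePow_add,
    Int.negOnePow_even (2 * (i + 1)) (even_two_mul _), mul_one]

theorem koszul_zero (a : A) : koszul 𝒜 0 a = a := by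
  refine ext_homogeneous (𝒜 := 𝒜) (T := LinearMap.id) ?_ a
  intro i a ha
  simp [koszul_of_mem _ ha]

theorem VField.map_mul {k : ℤ} {X : Module.End 𝕜 A} (hX : X ∈ VField 𝒜 k) (a b : A) :
    X (a * b) = X a * b + sgn 𝒜 k a * X b := by
  refine ext_homogeneous (𝒜 := 𝒜) (S := X ∘ₗ LinearMap.mulRight 𝕜 b)
    (T := LinearMap.mulRight 𝕜 b ∘ₗ X + LinearMap.mulRight 𝕜 (X b) ∘ₗ sgn 𝒜 k) ?_ a
  intro i a ha
  simp [hX.2 i a ha, sgn_of_mem k ha, Units.smul_def, mul_assoc]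

theorem IsDiffOp.map_mem {d : ℤ} {D : Module.End 𝕜 A} (hD : IsDiffOp 𝒜 d D) :
    ∀ i, ∀ a ∈ 𝒜 i, D a ∈ 𝒜 (i + d) := by
  induction hD with
  | mul hb =>
    intro i a ha
    rw [add_comm]
    exact SetLike.mul_mem_graded hb ha
  | field hX => exact hX.1
  | @comp d e _ _ _ _ h1 h2 =>
    intro i a ha
    have h := h1 _ _ (h2 i a ha)
    rwa [add_assoc, add_comm e d] at h
  | add _ _ h1 h2 => exact fun i a ha => add_mem (h1 i a ha) (h2 i a ha)

theorem IsDiffOp.sgn_apply {d : ℤ} {D : Module.End 𝕜 A} (hD : IsDiffOp 𝒜 d D) (k e : ℤ) (a : A) :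
    sgn 𝒜 k (D (koszul 𝒜 e a)) = (k * (d + 1)).negOnePow • D (koszul 𝒜 (k + e) a) := by
  rw [Units.smul_def]
  refine ext_homogeneous (𝒜 := 𝒜) (S := sgn 𝒜 k ∘ₗ D ∘ₗ koszul 𝒜 e)
    (T := ((k * (d + 1)).negOnePow : ℤ) • (D ∘ₗ koszul 𝒜 (k + e))) ?_ a
  intro i a ha
  simp only [LinearMap.comp_apply, koszul_of_mem _ ha, LinearMap.smul_apply, Units.smul_def,
    map_zsmul, sgn_of_mem k (hD.map_mem i a ha)]
  simp only [← Units.smul_def, smul_smul, ← Int.negOnePow_add]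
  congr 1
  rw [Int.negOnePow_eq_iff]
  exact ⟨-k, by ring⟩

/-! ### Closure of the polydifferential operators under the operations -/

theorem gerst_coch {n : ℕ} (h : n + 1 = 1 + n) (e : ℤ) (X : Module.End 𝕜 A) (F : Coch A n) :
    gerst 𝒜 h e (coch X) F = fun f => X (F f) := by
  funext f
  simp [gerst, coch]

theorem Dpoly.smul_left {n : ℕ} {q i : ℤ} {a : A} (ha : a ∈ 𝒜 i) {F : Coch A n}
    (hF : F ∈ Dpoly 𝒜 n q) : (fun f => a * F f) ∈ Dpoly 𝒜 n (i + q) := by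
  cases n with
  | zero =>
    have hF' : F default ∈ 𝒜 q := hF
    have h : a * F default ∈ 𝒜 (i + q) := SetLike.mul_mem_graded ha hF'
    exact h
  | succ n =>
    refine Submodule.span_induction (p := fun F _ => (fun f => a * F f) ∈ Dpoly 𝒜 (n + 1) (i + q))
      ?_ ?_ ?_ ?_ hF
    · rintro _ ⟨d, e, hde, D, hD, G, hG, rfl⟩
      refine Submodule.subset_span ⟨i + d, e, by omega, LinearMap.mulLeft 𝕜 a * D,
        IsDiffOp.comp (IsDiffOp.mul ha) hD, G, hG, ?_⟩
      funext f
      simp [cup, coch, mul_assoc]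
    · convert zero_mem (Dpoly 𝒜 (n + 1) (i + q)) using 1
      funext f
      simp
    · intro F G _ _ hF hG
      convert add_mem hF hG using 1
      funext f
      simp [mul_add]
    · intro c F _ hF
      convert Submodule.smul_mem _ c hF using 1
      funext f
      simp

theorem Dpoly.field_comp {n : ℕ} {q k : ℤ} {X : Module.End 𝕜 A} (hX : X ∈ VField 𝒜 k)
    {F : Coch A n} (hF : F ∈ Dpoly 𝒜 n q) : (fun f => X (F f)) ∈ Dpoly 𝒜 n (q + k) := by
  induction n generalizing q with
  | zero => exact hX.1 _ _ hF
  | succ n ih =>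
    refine Submodule.span_induction (p := fun F _ => (fun f => X (F f)) ∈ Dpoly 𝒜 (n + 1) (q + k))
      ?_ ?_ ?_ ?_ hF
    · rintro _ ⟨d, e, hde, D, hD, G, hG, rfl⟩
      have h1 : cup 𝒜 (Nat.add_comm 1 n) (n + e) (coch (X * D)) G ∈ Dpoly 𝒜 (n + 1) (q + k) :=
        Submodule.subset_span ⟨k + d, e, by omega, X * D, IsDiffOp.comp (IsDiffOp.field hX) hD,
          G, hG, rfl⟩
      have h2 : cup 𝒜 (Nat.add_comm 1 n) (n + (e + k)) (coch D) (fun f => X (G f)) ∈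
          Dpoly 𝒜 (n + 1) (q + k) :=
        Submodule.subset_span ⟨d, e + k, by omega, D, hD, _, ih hG, rfl⟩
      have h3 := add_mem h1 (zsmul_mem h2 ((k * (d + 1)).negOnePow : ℤ))
      convert h3 using 1
      funext f
      simp only [cup, coch, VField.map_mul hX, IsDiffOp.sgn_apply hD, Pi.add_apply, Pi.smul_apply,
        Units.smul_def, smul_mul_assoc, Module.End.mul_apply]
      rw [show k + ((n : ℤ) + e) = n + (e + k) by ring]
    · convert zero_mem (Dpoly 𝒜 (n + 1) (q + k)) using 1
      funext f
      simp
    · intro F G _ _ hF hG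
      convert add_mem hF hG using 1
      funext f
      simp
    · intro c F _ hF
      convert Submodule.smul_mem _ c hF using 1
      funext f
      simp

theorem Dpoly.diffOp_comp {d : ℤ} {D : Module.End 𝕜 A} (hD : IsDiffOp 𝒜 d D) :
    ∀ {n : ℕ} {q : ℤ} {F : Coch A n}, F ∈ Dpoly 𝒜 n q →
      (fun f => D (F f)) ∈ Dpoly 𝒜 n (q + d) := by
  induction hD with
  | mul ha =>
    intro n q F hF
    rw [add_comm]
    exact Dpoly.smul_left ha hF
  | field hX => exact fun hF => Dpoly.field_comp hX hF
  | @comp d e _ _ _ _ h1 h2 =>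
    intro n q F hF
    have h := h1 (h2 hF)
    rwa [add_assoc, add_comm e d] at h
  | add _ _ h1 h2 => exact fun hF => add_mem (h1 hF) (h2 hF)

theorem Dpoly.cup_mem {p q l : ℕ} (h : p + q = l) {r s : ℤ} {F : Coch A p} {G : Coch A q}
    (hF : F ∈ Dpoly 𝒜 p r) (hG : G ∈ Dpoly 𝒜 q s) :
    cup 𝒜 h (q + s) F G ∈ Dpoly 𝒜 l (r + s) := by
  induction p generalizing l r with
  | zero =>
    obtain rfl : q = l := by omega
    have h1 := Dpoly.smul_left (a := F default) hF hG
    convert h1 using 1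
    funext f
    simp only [cup]
    congr 2
    · exact Subsingleton.elim _ _
    · funext j
      congr 1
      simp
  | succ p ih =>
    obtain ⟨l, rfl⟩ : ∃ l', l = l' + 1 := ⟨p + q, by omega⟩
    have h' : p + q = l := by omega
    refine Submodule.span_induction
      (p := fun F _ => cup 𝒜 h (q + s) F G ∈ Dpoly 𝒜 (l + 1) (r + s)) ?_ ?_ ?_ ?_ hF
    · rintro _ ⟨d, e, hde, D, hD, F, hF, rfl⟩
      refine Submodule.subset_span ⟨d, e + s, by omega, D, hD, _, ih h' hF, ?_⟩
      funext f
      simp only [cup, coch, koszul_koszul, mul_assoc]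
      congr 3
      · subst h'
        push_cast
        congr 1
        ring
      · refine funext fun j => congrArg f (Fin.ext ?_)
        simp
        omega
    · convert zero_mem (Dpoly 𝒜 (l + 1) (r + s)) using 1
      funext f
      simp [cup]
    · intro F F' _ _ hF hF'
      convert add_mem hF hF' using 1
      funext f
      simp [cup, add_mul]
    · intro c F _ hF
      convert Submodule.smul_mem _ c hF using 1
      funext f
      simp [cup]

theorem IsDiffOp.koszul_apply {d : ℤ} {D : Module.End 𝕜 A} (hD : IsDiffOp 𝒜 d D) (e : ℤ) (a : A) :
    koszul 𝒜 e (D a) = (e * d).negOnePow • D (koszul 𝒜 e a) := by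
  rw [Units.smul_def]
  refine ext_homogeneous (𝒜 := 𝒜) (S := koszul 𝒜 e ∘ₗ D)
    (T := ((e * d).negOnePow : ℤ) • (D ∘ₗ koszul 𝒜 e)) ?_ a
  intro i a ha
  simp only [LinearMap.comp_apply, koszul_of_mem _ ha, LinearMap.smul_apply, Units.smul_def,
    map_zsmul, koszul_of_mem e (hD.map_mem i a ha)]
  simp only [← Units.smul_def, smul_smul, ← Int.negOnePow_add]
  congr 2
  ring

theorem koszul_mulCoch (e : ℤ) (a b : A) :
    koszul 𝒜 e (sgn 𝒜 1 a * b) =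
      (e + 1).negOnePow • (koszul 𝒜 1 (koszul 𝒜 e a) * koszul 𝒜 e b) := by
  rw [Units.smul_def]
  refine ext_homogeneous (𝒜 := 𝒜) (S := koszul 𝒜 e ∘ₗ LinearMap.mulRight 𝕜 b ∘ₗ sgn 𝒜 1)
    (T := ((e + 1).negOnePow : ℤ) •
      (LinearMap.mulRight 𝕜 (koszul 𝒜 e b) ∘ₗ koszul 𝒜 1 ∘ₗ koszul 𝒜 e)) ?_ a
  intro i a ha
  refine ext_homogeneous (𝒜 := 𝒜) (S := koszul 𝒜 e ∘ₗ LinearMap.mulLeft 𝕜 (sgn 𝒜 1 a))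
    (T := ((e + 1).negOnePow : ℤ) •
      (LinearMap.mulLeft 𝕜 (koszul 𝒜 1 (koszul 𝒜 e a)) ∘ₗ koszul 𝒜 e)) ?_ b
  intro j b hb
  simp only [LinearMap.comp_apply, LinearMap.mulLeft_apply, LinearMap.smul_apply,
    koszul_of_mem _ ha, koszul_of_mem _ hb, sgn_of_mem _ ha, Units.smul_def, smul_mul_assoc,
    map_zsmul, koszul_of_mem e (SetLike.mul_mem_graded ha hb)]
  simp only [← Units.smul_def, smul_smul, ← Int.negOnePow_add]
  congr 1
  rw [Int.negOnePow_eq_iff]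
  exact ⟨-(e + 1), by ring⟩

theorem gerst_cup {n m l : ℕ} (h : l + 1 + 1 = n + 1 + m) (h' : l + 1 = n + m) (c : 1 + n = n + 1)
    (e ε : ℤ) (D : Module.End 𝕜 A) (G : Coch A n) (E : Coch A m) (f : Fin (l + 1) → A) :
    gerst 𝒜 h ε (cup 𝒜 c e (coch D) G) E f =
      D (koszul 𝒜 e (E fun k => f ⟨k, by omega⟩)) * G (fun i => f ⟨i + m, by omega⟩) +
        D (koszul 𝒜 (e + (ε + 1)) (f 0)) * gerst 𝒜 h' ε G E (fun i => f i.succ) := by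
  simp only [gerst, Fin.sum_univ_succ, Finset.mul_sum]
  congr 1
  · simp only [cup, coch]
    refine congrArg₂ _ ?_ (congrArg G (funext fun i => ?_))
    · simp
    · have h1 : ¬ (⟨1 + i, by omega⟩ : Fin (n + 1)) < 0 := by simp
      have h2 : ¬ (⟨1 + i, by omega⟩ : Fin (n + 1)) = 0 := by simp [Fin.ext_iff]
      simp only [h1, h2, dif_neg, not_false_iff]
      refine congrArg f (Fin.ext ?_)
      simp
      omega
  · refine Finset.sum_congr rfl fun j _ => ?_
    simp only [cup, coch]
    refine congrArg₂ _ ?_ (congrArg G (funext fun i => ?_))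
    · simp [koszul_koszul]
    · have h1 : ((⟨1 + i, by omega⟩ : Fin (n + 1)) < j.succ) ↔ i < j := by
        simp only [Fin.lt_def, Fin.val_succ]
        omega
      have h2 : ((⟨1 + i, by omega⟩ : Fin (n + 1)) = j.succ) ↔ i = j := by
        simp only [Fin.ext_iff, Fin.val_succ]
        omega
      by_cases h3 : i < j
      · simp only [h1, h3, dif_pos]
        refine congrArg _ (congrArg f (Fin.ext ?_))
        simp
        omega
      · by_cases h4 : i = j
        · rw [dif_neg (mt h1.1 h3), dif_pos (h2.2 h4), dif_neg h3, dif_pos h4]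
          subst h4
          refine congrArg _ (funext fun k => congrArg f (Fin.ext ?_))
          simp
          omega
        · simp only [h1, h2, h3, h4, dif_neg, not_false_iff]
          refine congrArg f (Fin.ext ?_)
          have : j < i := by
            rcases lt_trichotomy i j with h | h | h <;> tauto
          simp
          omega

theorem gerst_zero_left {n m l : ℕ} (h : l + 1 = n + m) (e : ℤ) (E : Coch A m) :
    gerst 𝒜 h e (0 : Coch A n) E = 0 := by
  funext f
  simp [gerst]

theorem gerst_add_left {n m l : ℕ} (h : l + 1 = n + m) (e : ℤ) (F G : Coch A n) (E : Coch A m) :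
    gerst 𝒜 h e (F + G) E = gerst 𝒜 h e F E + gerst 𝒜 h e G E := by
  funext f
  simp [gerst, Finset.sum_add_distrib]

theorem gerst_smul_left {n m l : ℕ} (h : l + 1 = n + m) (e : ℤ) (c : 𝕜) (F : Coch A n)
    (E : Coch A m) : gerst 𝒜 h e (c • F) E = c • gerst 𝒜 h e F E := by
  funext f
  simp [gerst, Finset.smul_sum]

theorem Dpoly.comp_field {n : ℕ} (h : n + 1 = n + 1) {q : ℤ} {X : Module.End 𝕜 A}
    (hX : X ∈ VField 𝒜 1) {F : Coch A n} (hF : F ∈ Dpoly 𝒜 n q) :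
    gerst 𝒜 h 2 F (coch X) ∈ Dpoly 𝒜 n (q + 1) := by
  induction n generalizing q with
  | zero =>
    convert zero_mem (Dpoly 𝒜 0 (q + 1)) using 1
    funext f
    simp [gerst]
  | succ n ih =>
    refine Submodule.span_induction
      (p := fun F _ => gerst 𝒜 h 2 F (coch X) ∈ Dpoly 𝒜 (n + 1) (q + 1)) ?_ ?_ ?_ ?_ hF
    · rintro _ ⟨d, e, hde, D, hD, G, hG, rfl⟩
      have h1 : cup 𝒜 (Nat.add_comm 1 n) (n + e) (coch (D * X)) G ∈ Dpoly 𝒜 (n + 1) (q + 1) :=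
        Submodule.subset_span ⟨d + 1, e, by omega, D * X, IsDiffOp.comp hD (IsDiffOp.field hX),
          G, hG, rfl⟩
      have h2 : cup 𝒜 (Nat.add_comm 1 n) (n + (e + 1)) (coch D) (gerst 𝒜 rfl 2 G (coch X)) ∈
          Dpoly 𝒜 (n + 1) (q + 1) :=
        Submodule.subset_span ⟨d, e + 1, by omega, D, hD, _, ih rfl hG, rfl⟩
      have h3 := add_mem (zsmul_mem h1 (((n + e) * 1 : ℤ).negOnePow : ℤ)) h2
      convert h3 using 1
      funext f
      rw [gerst_cup h rfl]
      refine congrArg₂ _ ?_ ?_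
      · simp only [coch, cup, (IsDiffOp.field hX).koszul_apply, Units.smul_def, map_zsmul,
          Pi.smul_apply, smul_mul_assoc]
        congr 2
        refine congrArg G (funext fun j => congrArg f (Fin.ext ?_))
        simp
        omega
      · simp only [coch, cup]
        rw [show (n : ℤ) + e + (2 + 1) = n + (e + 1) + 2 by ring, koszul_add_two]
        refine congrArg₂ _ rfl (congrArg _ (funext fun j => congrArg f (Fin.ext ?_)))
        simp
        omega
    · rw [gerst_zero_left]
      exact zero_mem _
    · intro F G _ _ hF hG
      rw [gerst_add_left]
      exact add_mem hF hG
    · intro c F _ hF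
      rw [gerst_smul_left]
      exact Submodule.smul_mem _ c hF

theorem Dpoly.coproduct_mem {d : ℤ} {D : Module.End 𝕜 A} (hD : IsDiffOp 𝒜 d D) :
    (fun f : Fin 2 → A => D (koszul 𝒜 1 (f 0) * f 1)) ∈ Dpoly 𝒜 2 d := by
  have h0 : (fun _ => 1 : Coch A 0) ∈ Dpoly 𝒜 0 0 := SetLike.one_mem_graded 𝒜
  have h1 : IsDiffOp 𝒜 0 (1 : Module.End 𝕜 A) := by
    have h := IsDiffOp.mul (𝒜 := 𝒜) (SetLike.one_mem_graded 𝒜)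
    rwa [LinearMap.mulLeft_one] at h
  have h2 : (fun f : Fin 1 → A => f 0) ∈ Dpoly 𝒜 1 0 := by
    refine Submodule.subset_span ⟨0, 0, by simp, 1, h1, _, h0, ?_⟩
    funext f
    simp [cup, coch, koszul_zero]
  have h3 : (fun f : Fin 2 → A => koszul 𝒜 1 (f 0) * f 1) ∈ Dpoly 𝒜 2 0 := by
    refine Submodule.subset_span ⟨0, 0, by simp, 1, h1, _, h2, ?_⟩
    funext f
    simp [cup, coch]
  simpa using Dpoly.diffOp_comp hD h3

theorem Dpoly.comp_mulCoch {n : ℕ} (h : n + 1 + 1 = n + 2) {q : ℤ} {F : Coch A n}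
    (hF : F ∈ Dpoly 𝒜 n q) : gerst 𝒜 h 2 F (mulCoch 𝒜) ∈ Dpoly 𝒜 (n + 1) q := by
  induction n generalizing q with
  | zero =>
    convert zero_mem (Dpoly 𝒜 1 q) using 1
    funext f
    simp [gerst]
  | succ n ih =>
    refine Submodule.span_induction
      (p := fun F _ => gerst 𝒜 h 2 F (mulCoch 𝒜) ∈ Dpoly 𝒜 (n + 1 + 1) q) ?_ ?_ ?_ ?_ hF
    · rintro _ ⟨d, e, hde, D, hD, G, hG, rfl⟩
      have h1 : cup 𝒜 (Nat.add_comm 2 n) (n + e)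
          (fun f : Fin 2 → A => D (koszul 𝒜 1 (f 0) * f 1)) G ∈ Dpoly 𝒜 (n + 1 + 1) (d + e) :=
        Dpoly.cup_mem _ (Dpoly.coproduct_mem hD) hG
      have h2 : cup 𝒜 (Nat.add_comm 1 (n + 1)) ((n + 1 : ℕ) + e) (coch D)
          (gerst 𝒜 (n := n) (l := n + 1) rfl 2 G (mulCoch 𝒜)) ∈ Dpoly 𝒜 (n + 1 + 1) (d + e) :=
        Submodule.subset_span ⟨d, e, rfl, D, hD, _, ih rfl hG, rfl⟩
      have h3 := add_mem (zsmul_mem h1 ((n + e + 1 : ℤ).negOnePow : ℤ)) h2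
      rw [hde] at h3
      convert h3 using 1
      funext f
      rw [gerst_cup h rfl]
      refine congrArg₂ _ ?_ ?_
      · simp only [mulCoch, cup, koszul_mulCoch, Units.smul_def, map_zsmul,
          Pi.smul_apply, smul_mul_assoc]
        congr 2
        refine congrArg G (funext fun j => congrArg f (Fin.ext ?_))
        simp
        omega
      · simp only [coch, cup]
        rw [show (n : ℤ) + e + (2 + 1) = (n + 1 : ℕ) + e + 2 by push_cast; ring, koszul_add_two]
        refine congrArg₂ _ rfl (congrArg _ (funext fun j => congrArg f (Fin.ext ?_)))
        simp
        omega
    · rw [gerst_zero_left]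
      exact zero_mem _
    · intro F G _ _ hF hG
      rw [gerst_add_left]
      exact add_mem hF hG
    · intro c F _ hF
      rw [gerst_smul_left]
      exact Submodule.smul_mem _ c hF

theorem sgn_one_mul (a b : A) : sgn 𝒜 1 (a * b) = sgn 𝒜 1 a * sgn 𝒜 1 b := by
  refine ext_homogeneous (𝒜 := 𝒜) (S := sgn 𝒜 1 ∘ₗ LinearMap.mulRight 𝕜 b)
    (T := LinearMap.mulRight 𝕜 (sgn 𝒜 1 b) ∘ₗ sgn 𝒜 1) ?_ a
  intro i a ha
  refine ext_homogeneous (𝒜 := 𝒜) (S := sgn 𝒜 1 ∘ₗ LinearMap.mulLeft 𝕜 a)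
    (T := LinearMap.mulLeft 𝕜 (sgn 𝒜 1 a) ∘ₗ sgn 𝒜 1) ?_ b
  intro j b hb
  simp only [LinearMap.comp_apply, LinearMap.mulLeft_apply,
    sgn_of_mem _ ha, sgn_of_mem _ hb, sgn_of_mem _ (SetLike.mul_mem_graded ha hb),
    Units.smul_def, smul_mul_assoc, mul_smul_comm]
  simp only [← Units.smul_def, smul_smul, ← Int.negOnePow_add]
  congr 2
  ring

theorem isDiffOp_one : IsDiffOp 𝒜 0 (1 : Module.End 𝕜 A) := by
  have h := IsDiffOp.mul (𝒜 := 𝒜) (SetLike.one_mem_graded 𝒜)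
  rwa [LinearMap.mulLeft_one] at h

theorem Dpoly.sgn_apply {n : ℕ} {q : ℤ} {F : Coch A n} (hF : F ∈ Dpoly 𝒜 n q)
    (f : Fin n → A) :
    sgn 𝒜 1 (F f) = (n + q).negOnePow • F (fun i => koszul 𝒜 1 (f i)) := by
  induction n generalizing q with
  | zero =>
    have h : F f ∈ 𝒜 q := by
      rw [Subsingleton.elim f default]
      exact hF
    rw [sgn_of_mem 1 h, Subsingleton.elim (fun i => koszul 𝒜 1 (f i)) f]
    simp
  | succ n ih =>
    refine Submodule.span_induction (p := fun F _ =>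
      sgn 𝒜 1 (F f) = ((n + 1 : ℕ) + q).negOnePow • F (fun i => koszul 𝒜 1 (f i))) ?_ ?_ ?_ ?_ hF
    · rintro _ ⟨d, e, hde, D, hD, G, hG, rfl⟩
      simp only [cup, coch, sgn_one_mul, ih hG, IsDiffOp.sgn_apply hD, koszul_koszul]
      simp only [Units.smul_def, smul_mul_assoc, mul_smul_comm]
      simp only [← Units.smul_def, smul_smul, ← Int.negOnePow_add]
      rw [show (n : ℤ) + e + 1 * (d + 1) = (n + 1 : ℕ) + q by push_cast; rw [← hde]; ring,
        add_comm (1 : ℤ)]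
    · simp
    · intro F G _ _ hF hG
      simp [hF, hG]
    · intro c F _ hF
      simp only [Pi.smul_apply, map_smul, hF]
      rw [smul_comm]

theorem gerst_mulCoch {n : ℕ} (h : n + 1 + 1 = 2 + n) (e : ℤ) (F : Coch A n)
    (f : Fin (n + 1) → A) :
    gerst 𝒜 h e (mulCoch 𝒜) F f =
      sgn 𝒜 1 (F fun k => f ⟨k, by omega⟩) * f ⟨n, by omega⟩ +
        sgn 𝒜 1 (koszul 𝒜 (e + 1) (f 0)) * F fun k => f ⟨1 + k, by omega⟩ := by
  simp only [gerst, mulCoch, Fin.sum_univ_two]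
  simp

theorem Dpoly.mulCoch_comp {n : ℕ} (h : n + 1 + 1 = 2 + n) {q : ℤ} {F : Coch A n}
    (hF : F ∈ Dpoly 𝒜 n q) : gerst 𝒜 h (n + q) (mulCoch 𝒜) F ∈ Dpoly 𝒜 (n + 1) q := by
  have h0 : (fun _ => 1 : Coch A 0) ∈ Dpoly 𝒜 0 0 := SetLike.one_mem_graded 𝒜
  have h2 : (fun f : Fin 1 → A => f 0) ∈ Dpoly 𝒜 1 0 := by
    refine Submodule.subset_span ⟨0, 0, by simp, 1, isDiffOp_one, _, h0, ?_⟩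
    funext f
    simp [cup, coch, koszul_zero]
  have h3 := Dpoly.cup_mem (l := n + 1) rfl hF h2
  have h4 := Dpoly.cup_mem (l := n + 1) (Nat.add_comm 1 n) h2 hF
  rw [add_zero] at h3
  rw [zero_add] at h4
  convert add_mem (zsmul_mem h3 ((n + q : ℤ).negOnePow : ℤ)) (neg_mem h4) using 1
  funext f
  rw [gerst_mulCoch]
  simp only [cup, Pi.add_apply, Pi.smul_apply, Pi.neg_apply, Dpoly.sgn_apply hF, Units.smul_def,
    smul_mul_assoc]
  congr 1
  have h5 := isDiffOp_one.sgn_apply (𝒜 := 𝒜) 1 (n + q + 1) (f 0)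
  rw [show (1 : ℤ) + (n + q + 1) = n + q + 2 by ring, koszul_add_two] at h5
  simp only [Module.End.one_apply] at h5
  rw [h5]
  simp

/-! ## Total spaces -/

variable (𝒜)

/-- The space of vector fields, the direct sum of its homogeneous parts. Its shift by `[-1]` has
the same elements. -/
abbrev VectorFields : Type _ := ⨁ k : ℤ, VField 𝒜 k

/-- The space of differential operators, the direct sum of its homogeneous parts. -/
abbrev DiffOps : Type _ := ⨁ d : ℤ, DiffOp 𝒜 d

/-- The total space `tot D_poly`. The component `(n, q)` has total degree `n + q`. -/
def TotDpoly : Type _ := ⨁ i : ℕ × ℤ, Dpoly 𝒜 i.1 i.2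

instance : AddCommGroup (TotDpoly 𝒜) :=
  inferInstanceAs (AddCommGroup (⨁ i : ℕ × ℤ, Dpoly 𝒜 i.1 i.2))

instance : Module 𝕜 (TotDpoly 𝒜) :=
  inferInstanceAs (Module 𝕜 (⨁ i : ℕ × ℤ, Dpoly 𝒜 i.1 i.2))

variable {𝒜}

/-- The inclusion of the component of bidegree `i`. -/
def TotDpoly.of (i : ℕ × ℤ) : Dpoly 𝒜 i.1 i.2 →ₗ[𝕜] TotDpoly 𝒜 :=
  DirectSum.lof 𝕜 (ℕ × ℤ) (fun i => Dpoly 𝒜 i.1 i.2) i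

/-- The linear map on `tot D_poly` with the given components. -/
def TotDpoly.lift {N : Type*} [AddCommGroup N] [Module 𝕜 N]
    (f : ∀ i : ℕ × ℤ, Dpoly 𝒜 i.1 i.2 →ₗ[𝕜] N) : TotDpoly 𝒜 →ₗ[𝕜] N :=
  DirectSum.toModule 𝕜 (ℕ × ℤ) N f

theorem TotDpoly.lift_of {N : Type*} [AddCommGroup N] [Module 𝕜 N]
    (f : ∀ i : ℕ × ℤ, Dpoly 𝒜 i.1 i.2 →ₗ[𝕜] N) (i : ℕ × ℤ) (F : Dpoly 𝒜 i.1 i.2) :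
    TotDpoly.lift f (TotDpoly.of i F) = f i F := by
  change DirectSum.toModule 𝕜 (ℕ × ℤ) N f
    (DirectSum.lof 𝕜 (ℕ × ℤ) (fun i => Dpoly 𝒜 i.1 i.2) i F) = f i F
  exact DirectSum.toModule_lof (M := fun i : ℕ × ℤ => Dpoly 𝒜 i.1 i.2) 𝕜 i F

/-- The inclusion of the vector fields in the differential operators. -/
def fieldToDiffOp : VectorFields 𝒜 →ₗ[𝕜] DiffOps 𝒜 :=
  DirectSum.toModule 𝕜 ℤ _ fun k => DirectSum.lof 𝕜 ℤ (fun d => DiffOp 𝒜 d) k ∘ₗ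
    Submodule.inclusion fun _ hX => IsDiffOp.field hX

theorem coch_mem {d : ℤ} {D : Module.End 𝕜 A} (hD : D ∈ DiffOp 𝒜 d) : coch D ∈ Dpoly 𝒜 1 d := by
  have h0 : (fun _ => 1 : Coch A 0) ∈ Dpoly 𝒜 0 0 := SetLike.one_mem_graded 𝒜
  refine Submodule.subset_span ⟨d, 0, by simp, D, hD, _, h0, ?_⟩
  funext f
  simp [cup, coch, koszul_zero]

/-- The map `D ↦ D̄` from differential operators to `tot D_poly`. -/
def bar : DiffOps 𝒜 →ₗ[𝕜] TotDpoly 𝒜 :=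
  DirectSum.toModule 𝕜 ℤ _ fun d =>
    TotDpoly.of (1, d) ∘ₗ
      { toFun := fun D => (⟨coch D.1, coch_mem D.2⟩ : Dpoly 𝒜 1 d)
        map_add' := fun _ _ => rfl
        map_smul' := fun _ _ => rfl }

/-- The map `X ↦ X̄` from vector fields to `tot D_poly`. -/
def fieldBar : VectorFields 𝒜 →ₗ[𝕜] TotDpoly 𝒜 := bar ∘ₗ fieldToDiffOp

/-- The bilinear map on `tot D_poly` with the given components. -/
def totBilin (B : ∀ i j : ℕ × ℤ, Dpoly 𝒜 i.1 i.2 →ₗ[𝕜] Dpoly 𝒜 j.1 j.2 →ₗ[𝕜] TotDpoly 𝒜) :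
    TotDpoly 𝒜 →ₗ[𝕜] TotDpoly 𝒜 →ₗ[𝕜] TotDpoly 𝒜 :=
  TotDpoly.lift fun i =>
    (TotDpoly.lift fun j => (B i j).flip).flip

/-- The cup product on `tot D_poly`. -/
def totCup : TotDpoly 𝒜 →ₗ[𝕜] TotDpoly 𝒜 →ₗ[𝕜] TotDpoly 𝒜 :=
  totBilin fun i j => LinearMap.mk₂ 𝕜
    (fun F G => TotDpoly.of (i.1 + j.1, i.2 + j.2)
      ⟨cup 𝒜 rfl (j.1 + j.2) F.1 G.1, Dpoly.cup_mem rfl F.2 G.2⟩)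
    (fun F F' G => by
      rw [← map_add]
      congr 1
      ext f
      simp [cup, add_mul])
    (fun c F G => by
      rw [← map_smul]
      congr 1
      ext f
      simp [cup])
    (fun F G G' => by
      rw [← map_add]
      congr 1
      ext f
      simp [cup, mul_add])
    (fun c F G => by
      rw [← map_smul]
      congr 1
      ext f
      simp [cup])

/-- The unit of the cup product. -/
def totOne : TotDpoly 𝒜 :=
  TotDpoly.of (0, 0)
    ⟨fun _ => 1, SetLike.one_mem_graded 𝒜⟩

/-- The cup product `x₁ ∪ ⋯ ∪ xₙ` of a list. -/
def cupList (l : List (TotDpoly 𝒜)) : TotDpoly 𝒜 := l.foldr (fun x y => totCup x y) totOne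

/-- The opposite product `(x, y) ↦ (-1)^{|x||y|} y ∪ x` on `tot D_poly`. -/
def totCupOp : TotDpoly 𝒜 →ₗ[𝕜] TotDpoly 𝒜 →ₗ[𝕜] TotDpoly 𝒜 :=
  totBilin fun i j => (((i.1 + i.2) * (j.1 + j.2) : ℤ).negOnePow : ℤ) •
    totCup.flip.compl₁₂ (TotDpoly.of i) (TotDpoly.of j)

/-- The bracket `⟦x, y⟧ = x ∪ y - (-1)^{|x||y|} y ∪ x` on `tot D_poly`. -/
def totBracket : TotDpoly 𝒜 →ₗ[𝕜] TotDpoly 𝒜 →ₗ[𝕜] TotDpoly 𝒜 :=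
  totCup - totCupOp

/-- The differential `L_Q = [Q, ·]` on `tot D_poly`, where `[·,·]` is the Gerstenhaber bracket. -/
def totLQ (Q : VField 𝒜 1) : TotDpoly 𝒜 →ₗ[𝕜] TotDpoly 𝒜 :=
  TotDpoly.lift fun i =>
    TotDpoly.of (i.1, i.2 + 1) ∘ₗ
      { toFun := fun F => (⟨gBracket 𝒜 (Nat.add_comm i.1 1) 2 (i.1 + i.2) (coch Q.1) F.1, by
          rw [gBracket, gerst_coch, Units.smul_def]
          exact sub_mem (Dpoly.field_comp Q.2 F.2)
            (zsmul_mem (Dpoly.comp_field _ Q.2 F.2) _)⟩ : Dpoly 𝒜 i.1 (i.2 + 1))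
        map_add' := fun F G => by
          ext f
          simp [gBracket, gerst_coch, gerst_add_left]
          abel
        map_smul' := fun c F => by
          ext f
          simp [gBracket, gerst_coch, gerst_smul_left, smul_sub]
          rw [smul_comm] }

/-- The Hochschild differential `d_H = [m, ·]` on `tot D_poly`. -/
def totDH : TotDpoly 𝒜 →ₗ[𝕜] TotDpoly 𝒜 :=
  TotDpoly.lift fun i =>
    TotDpoly.of (i.1 + 1, i.2) ∘ₗ
      { toFun := fun F => (⟨gBracket 𝒜 (l := i.1 + 1) (by omega) 2 (i.1 + i.2) (mulCoch 𝒜) F.1, by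
          rw [gBracket, Units.smul_def]
          exact sub_mem (Dpoly.mulCoch_comp _ F.2)
            (zsmul_mem (Dpoly.comp_mulCoch _ F.2) _)⟩ : Dpoly 𝒜 (i.1 + 1) i.2)
        map_add' := fun F G => by
          ext f
          simp [gBracket, gerst_mulCoch, gerst_add_left, add_mul, mul_add]
          abel
        map_smul' := fun c F => by
          ext f
          simp [gBracket, gerst_mulCoch, gerst_smul_left, smul_sub, smul_add]
          rw [smul_comm] }

/-- The differential `L_Q + d_H` on `tot D_poly`. -/
def totD (Q : VField 𝒜 1) : TotDpoly 𝒜 →ₗ[𝕜] TotDpoly 𝒜 := totLQ Q + totDH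

/-- The canonical connection `∇_X F = X ∘ F` on `tot D_poly`, where `∘` is the Gerstenhaber
product. -/
def canConn : VectorFields 𝒜 →ₗ[𝕜] TotDpoly 𝒜 →ₗ[𝕜] TotDpoly 𝒜 :=
  DirectSum.toModule 𝕜 ℤ _ fun k =>
    (TotDpoly.lift fun i => (LinearMap.mk₂ 𝕜
      (fun (X : VField 𝒜 k) (F : Dpoly 𝒜 i.1 i.2) =>
        TotDpoly.of (i.1, i.2 + k)
          ⟨gerst 𝒜 (Nat.add_comm i.1 1) (i.1 + i.2) (coch X.1) F.1, by
            rw [gerst_coch]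
            exact Dpoly.field_comp X.2 F.2⟩)
      (fun X X' F => by
        rw [← map_add]
        congr 1
        ext f
        simp [gerst_coch])
      (fun c X F => by
        rw [← map_smul]
        congr 1
        ext f
        simp [gerst_coch])
      (fun X F F' => by
        rw [← map_add]
        congr 1
        ext f
        simp [gerst_coch])
      (fun c X F => by
        rw [← map_smul]
        congr 1
        ext f
        simp [gerst_coch])).flip).flip

/-- The bracket `[Q, X] = QX - (-1)^k XQ` of `Q` with a vector field `X` of degree `k`. -/
def adQ (Q : VField 𝒜 1) (k : ℤ) : VField 𝒜 k →ₗ[𝕜] VField 𝒜 (k + 1) where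
  toFun X := ⟨Q.1 * X.1 - k.negOnePow • (X.1 * Q.1), VField.bracket_mem Q.2 X.2⟩
  map_add' X Y := by
    ext f
    simp
    abel
  map_smul' c X := by
    ext f
    simp [smul_sub]
    rw [smul_comm]

/-- The Atiyah cocycle of a module `N` with differential `d`, with respect to a connection `∇`:
`α(X̄, ξ) = (-1)^k (d (∇_X ξ) - ∇_{[Q,X]} ξ - (-1)^k ∇_X (d ξ))` for `X` of degree `k`. -/
def atiyahCocycle (Q : VField 𝒜 1) {N : Type*} [AddCommGroup N] [Module 𝕜 N] (d : N →ₗ[𝕜] N)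
    (conn : VectorFields 𝒜 →ₗ[𝕜] N →ₗ[𝕜] N) : VectorFields 𝒜 →ₗ[𝕜] N →ₗ[𝕜] N :=
  DirectSum.toModule 𝕜 ℤ _ fun k => LinearMap.mk₂ 𝕜
    (fun (X : VField 𝒜 k) (ξ : N) => k.negOnePow •
      (d (conn (DirectSum.lof 𝕜 ℤ (fun k => VField 𝒜 k) k X) ξ)
        - conn (DirectSum.lof 𝕜 ℤ (fun k => VField 𝒜 k) (k + 1) (adQ Q k X)) ξ
        - k.negOnePow • conn (DirectSum.lof 𝕜 ℤ (fun k => VField 𝒜 k) k X) (d ξ)))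
    (fun X Y ξ => by
      simp only [map_add, LinearMap.add_apply, ← smul_add]
      congr 1
      simp only [smul_add]
      abel)
    (fun c X ξ => by
      simp only [map_smul, LinearMap.smul_apply]
      rw [smul_comm c]
      congr 1
      simp only [smul_sub]
      rw [smul_comm c])
    (fun X ξ η => by
      simp only [map_add, ← smul_add]
      congr 1
      simp only [smul_add]
      abel)
    (fun c X ξ => by
      simp only [map_smul]
      rw [smul_comm c]
      congr 1
      simp only [smul_sub]
      rw [smul_comm c])

/-! ## The free Lie algebra -/

variable (𝒜) in
/-- The total space of the free Lie algebra `L(D_poly^1)`: the smallest subspace of `tot D_poly`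
that contains `tot D_poly^1` and is closed under the bracket. -/
def freeLie : Submodule 𝕜 (TotDpoly 𝒜) :=
  sInf {S | LinearMap.range bar ≤ S ∧ ∀ x ∈ S, ∀ y ∈ S, totBracket x y ∈ S}

/-- The nested bracket `⟦x, ⟦x₁, ⋯ ⟦x_{n-1}, xₙ⟧ ⋯ ⟧⟧`, equal to `x` for the empty list. -/
def nestedBracket : TotDpoly 𝒜 → List (TotDpoly 𝒜) → TotDpoly 𝒜
  | x, [] => x
  | x, y :: l => totBracket x (nestedBracket y l)

theorem nestedBracket_mem (D : DiffOps 𝒜) (l : List (DiffOps 𝒜)) :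
    nestedBracket (bar D) (l.map bar) ∈ freeLie 𝒜 := by
  induction l generalizing D with
  | nil => exact Submodule.mem_sInf.2 fun S hS => hS.1 ⟨D, rfl⟩
  | cons E l ih =>
    refine Submodule.mem_sInf.2 fun S hS => hS.2 _ (hS.1 ⟨D, rfl⟩) _ ?_
    exact Submodule.mem_sInf.1 (ih E) S hS

/-- The restriction of a connection to an invariant subspace. -/
def restrictConn {N : Type*} [AddCommGroup N] [Module 𝕜 N] (L : Submodule 𝕜 N)
    (conn : VectorFields 𝒜 →ₗ[𝕜] N →ₗ[𝕜] N) (h : ∀ X, ∀ x ∈ L, conn X x ∈ L) :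
    VectorFields 𝒜 →ₗ[𝕜] L →ₗ[𝕜] L :=
  LinearMap.mk₂ 𝕜 (fun X x => ⟨conn X x, h X x x.2⟩)
    (fun X Y x => by ext1; simp) (fun c X x => by ext1; simp)
    (fun X x y => by ext1; simp) (fun c X x => by ext1; simp)

end Algebra

/-! ## Graded manifolds and dg manifolds -/

/-- The exponents of the monomials in homogeneous coordinates of degrees `deg`: the exponent of an
odd coordinate is at most `1`. -/
def IsExponent {m : ℕ} (deg : Fin m → ℤ) (α : Fin m →₀ ℕ) : Prop :=
  ∀ j, Odd (deg j) → α j ≤ 1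

/-- The degree of the monomial `ξ^α`. -/
def monDeg {m : ℕ} (deg : Fin m → ℤ) (α : Fin m →₀ ℕ) : ℤ := ∑ j, (α j : ℤ) * deg j

/-- The Koszul sign `ε` with `ξ^α ξ^β = ε ξ^{α+β}`, where `ξ^α = ξ₁^{α₁} ⋯ ξ_m^{α_m}`. -/
def monSign {m : ℕ} (deg : Fin m → ℤ) (α β : Fin m →₀ ℕ) : ℤˣ :=
  (∑ i, ∑ j, if j < i then (α i : ℤ) * (β j : ℤ) * (deg i * deg j) else 0).negOnePow

/-- The `𝕜`-valued smooth functions on an open subset `V` of `M`. -/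
abbrev SmoothFun (𝕜 : Type u) [RCLike 𝕜] (n : ℕ) {M : Type v} [TopologicalSpace M]
    [ChartedSpace (EuclideanSpace ℝ (Fin n)) M] (V : Opens M) : Type _ :=
  ContMDiffMap (modelWithCornersSelf ℝ (EuclideanSpace ℝ (Fin n)))
    (modelWithCornersSelf ℝ 𝕜) V 𝕜 ∞

/-- A graded manifold with underlying smooth manifold `M`: a sheaf of `ℤ`-graded commutative
`𝕜`-algebras on `M`, with sections `⨁ₖ grading U k = O U`, that is locally isomorphic to
`C^∞(U, 𝕜) ⊗ Ŝ(W^∨)` for a finite-dimensional graded vector space `W`. -/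
structure GradedManifold (𝕜 : Type u) [RCLike 𝕜] (n : ℕ) (M : Type v) [TopologicalSpace M]
    [ChartedSpace (EuclideanSpace ℝ (Fin n)) M] where
  /-- The sections over `U`. -/
  O : Opens M → Type w
  [ring : ∀ U, Ring (O U)]
  [algebra : ∀ U, Algebra 𝕜 (O U)]
  /-- The homogeneous sections over `U`. -/
  grading : ∀ U, ℤ → Submodule 𝕜 (O U)
  [graded : ∀ U, GradedAlgebra (grading U)]
  graded_comm : ∀ U i j, ∀ a ∈ grading U i, ∀ b ∈ grading U j,
    a * b = (i * j).negOnePow • (b * a)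
  /-- The restriction of sections. -/
  res : ∀ {U V : Opens M}, V ≤ U → O U →ₐ[𝕜] O V
  res_mem : ∀ {U V : Opens M} (h : V ≤ U) (i : ℤ), ∀ a ∈ grading U i, res h a ∈ grading V i
  res_self : ∀ (U : Opens M) (a : O U), res (le_refl U) a = a
  res_res : ∀ {U V W : Opens M} (h : V ≤ U) (h' : W ≤ V) (a : O U),
    res h' (res h a) = res (h'.trans h) a
  /-- The sheaf condition, in each degree. -/
  glue : ∀ (i : ℤ) (𝒰 : Set (Opens M)) (s : ∀ U : 𝒰, O U.1),
    (∀ U : 𝒰, s U ∈ grading U.1 i) →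
    (∀ U V : 𝒰, res (inf_le_left : U.1 ⊓ V.1 ≤ U.1) (s U) = res inf_le_right (s V)) →
    ∃! t : O (sSup 𝒰), t ∈ grading (sSup 𝒰) i ∧ ∀ U : 𝒰, res (le_sSup U.2) t = s U
  /-- The degrees of a homogeneous basis `ξ₁,…,ξ_m` of `W^∨`. -/
  {m : ℕ}
  deg : Fin m → ℤ
  /-- Around each point, the homogeneous sections are the formal power series
  `∑_α c_α ξ^α` with coefficients in the smooth functions, compatibly with products and
  restrictions; `c V h s α` is the coefficient of `ξ^α` in `s`. -/
  locallyTrivial : ∀ x : M, ∃ U : Opens M, x ∈ U ∧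
    ∃ c : ∀ V : Opens M, V ≤ U → O V → (Fin m →₀ ℕ) →
      SmoothFun 𝕜 n V,
      (∀ (V : Opens M) (h : V ≤ U) s t α (y : V), c V h (s + t) α y = c V h s α y + c V h t α y) ∧
      (∀ (V : Opens M) (h : V ≤ U) (a : 𝕜) s α (y : V), c V h (a • s) α y = a * c V h s α y) ∧
      (∀ (V : Opens M) (h : V ≤ U) α (y : V), c V h 1 α y = if α = 0 then 1 else 0) ∧
      (∀ (V : Opens M) (h : V ≤ U) s t γ (y : V), IsExponent deg γ → c V h (s * t) γ y =
        ∑ p ∈ Finset.HasAntidiagonal.antidiagonal γ, ((monSign deg p.1 p.2 : ℤ) : 𝕜) *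
          (c V h s p.1 y * c V h t p.2 y)) ∧
      (∀ (V : Opens M) (h : V ≤ U) (W : Opens M) (h' : W ≤ V) s α (y : W), c W (h'.trans h) (res h' s) α y = c V h s α ⟨y, h' y.2⟩) ∧
      (∀ (V : Opens M) (h : V ≤ U) i, ∀ s ∈ grading V i, ∀ α, ¬ (IsExponent deg α ∧ monDeg deg α = i) →
        c V h s α = 0) ∧
      (∀ (V : Opens M) (h : V ≤ U) i (e : (Fin m →₀ ℕ) → SmoothFun 𝕜 n V),
        (∀ α, ¬ (IsExponent deg α ∧ monDeg deg α = i) → e α = 0) →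
        ∃! s : O V, s ∈ grading V i ∧ c V h s = e)

attribute [instance] GradedManifold.ring GradedManifold.algebra GradedManifold.graded

/-- A dg manifold: a graded manifold with a vector field `Q` of degree `1` with `Q² = 0`. -/
structure DGManifold (𝕜 : Type u) [RCLike 𝕜] (n : ℕ) (M : Type v) [TopologicalSpace M]
    [ChartedSpace (EuclideanSpace ℝ (Fin n)) M] extends GradedManifold.{u, v, w} 𝕜 n M where
  /-- The homological vector field. -/
  Q : VField (grading ⊤) 1
  sq_zero : Q.1 * Q.1 = 0

/-- The grading of the algebra `C^∞_𝓜` of global sections. -/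
abbrev DGManifold.functions {𝕜 : Type u} [RCLike 𝕜] {n : ℕ} {M : Type v} [TopologicalSpace M]
    [ChartedSpace (EuclideanSpace ℝ (Fin n)) M] (𝓜 : DGManifold.{u, v, w} 𝕜 n M) :
    ℤ → Submodule 𝕜 (𝓜.O ⊤) := 𝓜.grading ⊤

section Algebra

variable {𝕜 : Type u} [Field 𝕜] {A : Type v} [Ring A] [Algebra 𝕜 A]
variable {𝒜 : ℤ → Submodule 𝕜 A} [GradedAlgebra 𝒜]

/-! ## Signs -/

/-! For a cochain E of total degree 2 write R_E(F) = (-1)^{|F|} F ∘ E, and let id be the identity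
operator, of total degree 1. Expanding the Gerstenhaber brackets gives L_Q = ∇_Q + R_Q (`totLQ_eq`)
and d_H = -⟦id, ·⟧ + R_m (`totDH_eq`).

Let X have degree k. The Atiyah cocycle measures how far ∇_X is from commuting with L_Q + d_H,
corrected by ∇_{[Q,X]}. The summand ∇_Q contributes nothing after this correction, since ∇ is
composition of operators and hence flat (`canConn_adQ`). The summands R_Q and R_m contribute
nothing, since left and right composition commute up to the sign (-1)^k (`canConn_rightComp`). Only
-⟦id, ·⟧ is left. As X is a derivation of functions, ∇_X is a derivation of the cup product and so
of the bracket; with X ∘ id = X this gives ∇_X ⟦id, x⟧ = ⟦X̄, x⟧ + (-1)^k ⟦id, ∇_X x⟧. The last term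
cancels and ⟦X̄, x⟧ remains. The argument works for every x in tot D_poly (`atiyahCocycle_canConn`).

For the free Lie algebra only stability needs proof; the formula then restricts. The operators ∇_X,
R_Q and R_m are derivations of the bracket, so it suffices to look at generators
(`freeLie_derivation`). There X ∘ D and D ∘ Q are again differential operators. The delicate case is
D ∘ m: since ⟦id, id⟧ = -2m, the cochain m lies in the free Lie algebra, and this algebra is stable
under left composition with every differential operator (`leftComp_mem_freeLie`). That last fact
rests on graded commutativity, which makes the bracket linear over functions. -/

theorem sgn_mul (k : ℤ) (a b : A) : sgn 𝒜 k (a * b) = sgn 𝒜 k a * sgn 𝒜 k b := by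
  refine ext_homogeneous (𝒜 := 𝒜) (S := sgn 𝒜 k ∘ₗ LinearMap.mulRight 𝕜 b)
    (T := LinearMap.mulRight 𝕜 (sgn 𝒜 k b) ∘ₗ sgn 𝒜 k) ?_ a
  intro i a ha
  refine ext_homogeneous (𝒜 := 𝒜) (S := sgn 𝒜 k ∘ₗ LinearMap.mulLeft 𝕜 a)
    (T := LinearMap.mulLeft 𝕜 (sgn 𝒜 k a) ∘ₗ sgn 𝒜 k) ?_ b
  intro j b hb
  simp only [LinearMap.comp_apply, LinearMap.mulLeft_apply,
    sgn_of_mem _ ha, sgn_of_mem _ hb, sgn_of_mem _ (SetLike.mul_mem_graded ha hb),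
    Units.smul_def, smul_mul_assoc, mul_smul_comm]
  simp only [← Units.smul_def, smul_smul, ← Int.negOnePow_add]
  congr 2
  ring

theorem koszul_add_even (e i : ℤ) (a : A) : koszul 𝒜 (e + i + i) a = koszul 𝒜 e a := by
  refine ext_homogeneous (𝒜 := 𝒜) ?_ a
  intro j a ha
  rw [koszul_of_mem _ ha, koszul_of_mem _ ha, add_assoc, add_mul, Int.negOnePow_add,
    Int.negOnePow_even ((i + i) * (j + 1)) ((Even.add_self i).mul_right _), mul_one]

theorem koszul_eq_sgn (e : ℤ) (a : A) : koszul 𝒜 e a = e.negOnePow • sgn 𝒜 e a := rfl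

theorem sgn_eq_koszul (e : ℤ) (a : A) : sgn 𝒜 e a = e.negOnePow • koszul 𝒜 e a := by
  rw [koszul_eq_sgn, smul_smul, ← Int.negOnePow_add, Int.negOnePow_even _ (Even.add_self e),
    one_smul]

theorem sgn_one_koszul (e : ℤ) (a : A) : sgn 𝒜 1 (koszul 𝒜 (e + 1) a) = -koszul 𝒜 e a := by
  rw [sgn_eq_koszul, koszul_koszul, show 1 + (e + 1) = e + 2 by ring, koszul_add_two]
  simp

theorem VField.sgn_apply {k : ℤ} {X : Module.End 𝕜 A} (hX : X ∈ VField 𝒜 k) (l : ℤ) (a : A) :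
    sgn 𝒜 l (X a) = (l * k).negOnePow • X (sgn 𝒜 l a) := by
  rw [sgn_eq_koszul, (IsDiffOp.field hX).koszul_apply, koszul_eq_sgn]
  simp only [Units.smul_def, map_zsmul]
  simp only [← Units.smul_def, smul_smul, ← Int.negOnePow_add]
  congr 1
  rw [Int.negOnePow_eq_iff]
  exact ⟨l, by ring⟩

/-- Graded commutativity with a homogeneous and an arbitrary element. -/
theorem mul_eq_sgn_mul
    (hcomm : ∀ i j, ∀ a ∈ 𝒜 i, ∀ b ∈ 𝒜 j, a * b = (i * j).negOnePow • (b * a))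
    {i : ℤ} {a : A} (ha : a ∈ 𝒜 i) (b : A) : b * a = a * sgn 𝒜 i b := by
  refine ext_homogeneous (𝒜 := 𝒜) (S := LinearMap.mulRight 𝕜 a)
    (T := LinearMap.mulLeft 𝕜 a ∘ₗ sgn 𝒜 i) ?_ b
  intro j b hb
  simp only [LinearMap.comp_apply, LinearMap.mulLeft_apply, LinearMap.mulRight_apply,
    sgn_of_mem _ hb, Units.smul_def, mul_smul_comm]
  rw [← Units.smul_def, hcomm j i b hb a ha, mul_comm i j]

/-- Polydifferential operators are compatible with signs. -/
theorem Dpoly.sgn_koszul_apply {n : ℕ} {q : ℤ} {F : Coch A n} (hF : F ∈ Dpoly 𝒜 n q) (k e : ℤ)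
    (f : Fin n → A) :
    sgn 𝒜 k (F fun i => koszul 𝒜 e (f i)) =
      (k * (n + q)).negOnePow • F (fun i => koszul 𝒜 (e + k) (f i)) := by
  induction n generalizing q with
  | zero =>
    have h : F (fun i => koszul 𝒜 e (f i)) ∈ 𝒜 q := by
      rw [Subsingleton.elim (fun i => koszul 𝒜 e (f i)) default]
      exact hF
    rw [sgn_of_mem k h, Subsingleton.elim (fun i => koszul 𝒜 e (f i)) fun i => koszul 𝒜 (e + k) (f i)]
    simp
  | succ n ih =>
    refine Submodule.span_induction (p := fun F _ => sgn 𝒜 k (F fun i => koszul 𝒜 e (f i)) =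
      (k * ((n + 1 : ℕ) + q)).negOnePow • F (fun i => koszul 𝒜 (e + k) (f i))) ?_ ?_ ?_ ?_ hF
    · rintro _ ⟨d, e', hde, D, hD, G, hG, rfl⟩
      simp only [cup, coch, sgn_mul, ih hG, koszul_koszul, IsDiffOp.sgn_apply hD]
      simp only [Units.smul_def, smul_mul_assoc, mul_smul_comm]
      simp only [← Units.smul_def, smul_smul, ← Int.negOnePow_add]
      rw [show k * ((n : ℤ) + e') + k * (d + 1) = k * ((n + 1 : ℕ) + q) by
          push_cast; rw [← hde]; ring,
        show k + ((n : ℤ) + e' + e) = n + e' + (e + k) by ring]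
    · simp
    · intro F G _ _ hF hG
      simp [hF, hG]
    · intro c F _ hF
      simp only [Pi.smul_apply, map_smul, hF]
      rw [smul_comm]

/-! ## Identities for cochains -/

/-- The Leibniz rule for X on a product of two values: passing X over F with its arguments costs the
sign k|F| and also (-1)^{k(|f_i|+1)} for each argument, which the cup product absorbs because |X ∘
G| = |G| + k. -/
theorem VField.apply_cup {p q l : ℕ} (h : p + q = l) {r k : ℤ} {X : Module.End 𝕜 A}
    (hX : X ∈ VField 𝒜 k) {F : Coch A p} (hF : F ∈ Dpoly 𝒜 p r) (e : ℤ) (G : Coch A q)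
    (f : Fin l → A) :
    X (cup 𝒜 h e F G f) = cup 𝒜 h e (fun f => X (F f)) G f +
      (k * (p + r)).negOnePow • cup 𝒜 h (e + k) F (fun f => X (G f)) f := by
  simp only [cup, VField.map_mul hX, Dpoly.sgn_koszul_apply hF, Units.smul_def, smul_mul_assoc]

/-- Graded commutativity lets a function pass the first factor, so it can be attached to the second
one. This is what makes the term y ∪ x of the bracket linear in x over functions. -/
theorem mul_cup
    (hcomm : ∀ i j, ∀ a ∈ 𝒜 i, ∀ b ∈ 𝒜 j, a * b = (i * j).negOnePow • (b * a))
    {p q l : ℕ} (h : p + q = l) {r i : ℤ} {a : A} (ha : a ∈ 𝒜 i) {F : Coch A p}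
    (hF : F ∈ Dpoly 𝒜 p r) (e : ℤ) (G : Coch A q) (f : Fin l → A) :
    a * cup 𝒜 h e F G f = (i * (p + r)).negOnePow • cup 𝒜 h (e + i) F (fun f => a * G f) f := by
  simp only [cup, ← mul_assoc, mul_eq_sgn_mul hcomm ha]
  rw [mul_assoc a, mul_assoc a, Dpoly.sgn_koszul_apply hF]
  simp only [Units.smul_def, smul_mul_assoc, mul_smul_comm]
  simp only [← Units.smul_def, smul_smul, ← Int.negOnePow_add]
  -- The sign i|F| occurs twice, in the statement and from commuting a past F, and cancels. The
  -- arguments have picked up the exponent i twice as well.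
  rw [Int.negOnePow_even _ (Even.add_self _), one_smul]
  simp only [koszul_add_even]

/-- Right composition with a cochain of total degree `2` is a derivation of the cup product. -/
theorem gerst_cup_right {r : ℕ} {E : Coch A (r + 1)}
    (hE : ∀ e f, koszul 𝒜 e (E f) = e.negOnePow • E fun i => koszul 𝒜 e (f i))
    {p q l a b L : ℕ} (h : p + q = l) (hL : L + 1 = l + (r + 1)) (ha : a + 1 = p + (r + 1))
    (hb : b + 1 = q + (r + 1)) (haq : a + q = L) (hpb : p + b = L) {s : ℤ} {F : Coch A p}
    (hF : F ∈ Dpoly 𝒜 p s) (e : ℤ) (G : Coch A q) (f : Fin L → A) :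
    gerst 𝒜 hL 2 (cup 𝒜 h e F G) E f =
      cup 𝒜 hpb (e + 1) F (gerst 𝒜 hb 2 G E) f +
        e.negOnePow • cup 𝒜 haq e (gerst 𝒜 ha 2 F E) G f := by
  induction p generalizing l a L s with
  | zero =>
    obtain rfl : q = l := by omega
    obtain rfl : b = L := by omega
    -- A cochain without arguments offers no slot for E, so only insertions into G survive.
    have h0 : gerst 𝒜 ha 2 F E = 0 := by
      funext f
      simp [gerst]
    rw [h0]
    have h1 : ∀ f g : Fin 0 → A, F f = F g := fun f g => congrArg F (Subsingleton.elim f g)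
    simp only [gerst, cup, Pi.zero_apply, zero_mul, smul_zero, add_zero, zero_add, Fin.eta]
    rw [Finset.mul_sum]
    exact Finset.sum_congr rfl fun j _ => congrArg (· * _) (h1 _ _)
  | succ p ih =>
    obtain ⟨l, rfl⟩ : ∃ l', l = l' + 1 := ⟨p + q, by omega⟩
    obtain ⟨L, rfl⟩ : ∃ L', L = L' + 1 := ⟨l + r, by omega⟩
    obtain ⟨a, rfl⟩ : ∃ a', a = a' + 1 := ⟨p + r, by omega⟩
    have h' : p + q = l := by omega
    have hL' : L + 1 = l + (r + 1) := by omega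
    have ha' : a + 1 = p + (r + 1) := by omega
    refine Submodule.span_induction (p := fun F _ => gerst 𝒜 hL 2 (cup 𝒜 h e F G) E f =
      cup 𝒜 hpb (e + 1) F (gerst 𝒜 hb 2 G E) f +
        e.negOnePow • cup 𝒜 haq e (gerst 𝒜 ha 2 F E) G f) ?_ ?_ ?_ ?_ hF
    · rintro _ ⟨d, e', hde, D, hD, F, hF, rfl⟩
      -- Associativity brings the first operator to the front; `gerst_cup` then splits off the
      -- insertion into its slot, and the induction hypothesis covers the other slots.
      have hassoc : cup 𝒜 h e (cup 𝒜 (Nat.add_comm 1 p) (p + e') (coch D) F) G =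
          cup 𝒜 (Nat.add_comm 1 l) (p + e' + e) (coch D) (cup 𝒜 h' e F G) := by
        funext f
        simp only [cup, coch, koszul_koszul, mul_assoc]
        congr 3
        refine funext fun j => congrArg f (Fin.ext ?_)
        simp
        omega
      rw [hassoc, gerst_cup hL hL', ih h' hL' ha' (by omega) (by omega) hF]
      simp only [cup, gerst_cup ha ha', koszul_koszul, hE, coch]
      -- Both sides now agree up to rewriting argument positions and up to an even shift of the
      -- Koszul exponents.
      have e1 : ∀ j : ℕ, p + j + (r + 1) = a + 1 + j := by omega
      have e2 : ∀ j : ℕ, p + j + 1 = p + 1 + j := by omega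
      have e3 : ∀ j : ℕ, a + j + 1 = a + 1 + j := by omega
      have e4 : (p + e' + (2 + 1) + e : ℤ) = p + e' + (e + 1) + 2 := by ring
      have e5 : (p + e' + e + (2 + 1) : ℤ) = p + e' + (e + 1) + 2 := by ring
      simp only [e1, e2, e3, e4, e5, koszul_add_two, Fin.succ_mk, Nat.add_comm 1, Fin.val_zero,
        Fin.mk_zero, Fin.val_succ, Int.negOnePow_add (p + e') e, Units.smul_def,
        map_zsmul, mul_smul, mul_add, add_mul, smul_add, smul_mul_assoc, mul_smul_comm, mul_assoc]
      rw [smul_comm]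
      abel
    · rw [gerst_zero_left]
      simp [cup, gerst]
    · intro F F' _ _ hF hF'
      have hc : ∀ {p q l : ℕ} (h : p + q = l) (e : ℤ) (F F' : Coch A p) (G : Coch A q),
          cup 𝒜 h e (F + F') G = cup 𝒜 h e F G + cup 𝒜 h e F' G := by
        intros
        funext f
        simp [cup, add_mul]
      simp only [hc, gerst_add_left, Pi.add_apply, hF, hF', smul_add]
      abel
    · intro c F _ hF
      have hc : ∀ {p q l : ℕ} (h : p + q = l) (e : ℤ) (F : Coch A p) (G : Coch A q),
          cup 𝒜 h e (c • F) G = c • cup 𝒜 h e F G := by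
        intros
        funext f
        simp [cup]
      simp only [hc, gerst_smul_left, Pi.smul_apply, hF, smul_add]
      rw [smul_comm c]

/-! ## The operations on the total space -/

theorem TotDpoly.induction {p : TotDpoly 𝒜 → Prop} (x : TotDpoly 𝒜) (zero : p 0)
    (of : ∀ i F, p (TotDpoly.of i F)) (add : ∀ x y, p x → p y → p (x + y)) : p x :=
  DirectSum.induction_on x zero of add

/-- Vertical degrees such as r + s + k and r + k + s are equal only propositionally; this identifies
the corresponding components without casts. -/
theorem TotDpoly.of_congr {n : ℕ} {q q' : ℤ} (h : q = q') {F F' : Coch A n}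
    (hF : F ∈ Dpoly 𝒜 n q) (hF' : F' ∈ Dpoly 𝒜 n q') (hFF' : F = F') :
    TotDpoly.of (n, q) ⟨F, hF⟩ = TotDpoly.of (n, q') ⟨F', hF'⟩ := by
  subst h hFF'
  rfl

theorem TotDpoly.of_add {n : ℕ} {q : ℤ} {F G : Coch A n} (hF : F ∈ Dpoly 𝒜 n q)
    (hG : G ∈ Dpoly 𝒜 n q) :
    TotDpoly.of (n, q) ⟨F, hF⟩ + TotDpoly.of (n, q) ⟨G, hG⟩ =
      TotDpoly.of (n, q) ⟨F + G, add_mem hF hG⟩ :=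
  (map_add (TotDpoly.of (𝒜 := 𝒜) (n, q)) ⟨F, hF⟩ ⟨G, hG⟩).symm

theorem TotDpoly.of_sub {n : ℕ} {q : ℤ} {F G : Coch A n} (hF : F ∈ Dpoly 𝒜 n q)
    (hG : G ∈ Dpoly 𝒜 n q) :
    TotDpoly.of (n, q) ⟨F, hF⟩ - TotDpoly.of (n, q) ⟨G, hG⟩ =
      TotDpoly.of (n, q) ⟨F - G, sub_mem hF hG⟩ :=
  (map_sub (TotDpoly.of (𝒜 := 𝒜) (n, q)) ⟨F, hF⟩ ⟨G, hG⟩).symm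

theorem TotDpoly.neg_of {n : ℕ} {q : ℤ} {F : Coch A n} (hF : F ∈ Dpoly 𝒜 n q) :
    -TotDpoly.of (n, q) ⟨F, hF⟩ = TotDpoly.of (n, q) ⟨-F, neg_mem hF⟩ :=
  (map_neg (TotDpoly.of (𝒜 := 𝒜) (n, q)) ⟨F, hF⟩).symm

theorem TotDpoly.smul_of {n : ℕ} {q : ℤ} {F : Coch A n} (hF : F ∈ Dpoly 𝒜 n q) (c : 𝕜) :
    c • TotDpoly.of (n, q) ⟨F, hF⟩ =
      TotDpoly.of (n, q) ⟨c • F, Submodule.smul_mem _ c hF⟩ :=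
  (map_smul (TotDpoly.of (𝒜 := 𝒜) (n, q)) c ⟨F, hF⟩).symm

theorem Dpoly.units_smul_mem {n : ℕ} {q : ℤ} {F : Coch A n} (hF : F ∈ Dpoly 𝒜 n q) (ε : ℤˣ) :
    ε • F ∈ Dpoly 𝒜 n q :=
  zsmul_mem hF ε

theorem TotDpoly.units_smul_of {n : ℕ} {q : ℤ} {F : Coch A n} (hF : F ∈ Dpoly 𝒜 n q) (ε : ℤˣ) :
    ε • TotDpoly.of (n, q) ⟨F, hF⟩ =
      TotDpoly.of (n, q) ⟨ε • F, Dpoly.units_smul_mem hF ε⟩ :=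
  (map_zsmul (TotDpoly.of (𝒜 := 𝒜) (n, q)) (ε : ℤ) ⟨F, hF⟩).symm

theorem totBilin_of
    (B : ∀ i j : ℕ × ℤ, Dpoly 𝒜 i.1 i.2 →ₗ[𝕜] Dpoly 𝒜 j.1 j.2 →ₗ[𝕜] TotDpoly 𝒜)
    (i j : ℕ × ℤ) (F : Dpoly 𝒜 i.1 i.2) (G : Dpoly 𝒜 j.1 j.2) :
    totBilin B (TotDpoly.of i F) (TotDpoly.of j G) = B i j F G := by
  rw [totBilin, TotDpoly.lift_of, LinearMap.flip_apply, TotDpoly.lift_of, LinearMap.flip_apply]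

/-- The free indices l and t allow the product to be placed in a component whose index is only
provably the sum. -/
theorem totCup_of {p q l : ℕ} {r s t : ℤ} (h : p + q = l) (ht : r + s = t) {F : Coch A p}
    {G : Coch A q} (hF : F ∈ Dpoly 𝒜 p r) (hG : G ∈ Dpoly 𝒜 q s)
    (hFG : cup 𝒜 h (q + s) F G ∈ Dpoly 𝒜 l t) :
    totCup (TotDpoly.of (p, r) ⟨F, hF⟩) (TotDpoly.of (q, s) ⟨G, hG⟩) =
      TotDpoly.of (l, t) ⟨cup 𝒜 h (q + s) F G, hFG⟩ := by
  subst h ht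
  exact totBilin_of _ _ _ _ _

theorem totBracket_of (i j : ℕ × ℤ) (F : Dpoly 𝒜 i.1 i.2) (G : Dpoly 𝒜 j.1 j.2) :
    totBracket (TotDpoly.of i F) (TotDpoly.of j G) =
      totCup (TotDpoly.of i F) (TotDpoly.of j G) -
        ((i.1 + i.2) * (j.1 + j.2) : ℤ).negOnePow •
          totCup (TotDpoly.of j G) (TotDpoly.of i F) := by
  rw [totBracket, LinearMap.sub_apply, LinearMap.sub_apply, totCupOp, totBilin_of]
  rfl

theorem canConn_of {k : ℤ} {X : Module.End 𝕜 A} (hX : X ∈ VField 𝒜 k) {n : ℕ} {q : ℤ}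
    {F : Coch A n} (hF : F ∈ Dpoly 𝒜 n q) :
    canConn (DirectSum.lof 𝕜 ℤ (fun k => VField 𝒜 k) k ⟨X, hX⟩) (TotDpoly.of (n, q) ⟨F, hF⟩) =
      TotDpoly.of (n, q + k) ⟨fun f => X (F f), Dpoly.field_comp hX hF⟩ := by
  rw [canConn, DirectSum.toModule_lof, LinearMap.flip_apply, TotDpoly.lift_of,
    LinearMap.flip_apply, LinearMap.mk₂_apply]
  exact TotDpoly.of_congr rfl _ _ (gerst_coch _ _ X F)

theorem bar_lof {d : ℤ} {D : Module.End 𝕜 A} (hD : D ∈ DiffOp 𝒜 d) :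
    bar (DirectSum.lof 𝕜 ℤ (fun d => DiffOp 𝒜 d) d ⟨D, hD⟩) =
      TotDpoly.of (1, d) ⟨coch D, coch_mem hD⟩ := by
  rw [bar, DirectSum.toModule_lof]
  rfl

theorem fieldBar_lof {k : ℤ} {X : Module.End 𝕜 A} (hX : X ∈ VField 𝒜 k) :
    fieldBar (DirectSum.lof 𝕜 ℤ (fun k => VField 𝒜 k) k ⟨X, hX⟩) =
      TotDpoly.of (1, k) ⟨coch X, coch_mem (IsDiffOp.field hX)⟩ := by
  rw [fieldBar, LinearMap.comp_apply, fieldToDiffOp, DirectSum.toModule_lof]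
  exact bar_lof _

/-- The linear map `x ↦ (-1)^{k|x|} x` on `tot D_poly`. -/
def totSgn (k : ℤ) : TotDpoly 𝒜 →ₗ[𝕜] TotDpoly 𝒜 :=
  TotDpoly.lift fun i => ((k * (i.1 + i.2)).negOnePow : ℤ) • TotDpoly.of i

theorem totSgn_of (k : ℤ) (i : ℕ × ℤ) (F : Dpoly 𝒜 i.1 i.2) :
    totSgn k (TotDpoly.of i F) = (k * (i.1 + i.2)).negOnePow • TotDpoly.of i F :=
  TotDpoly.lift_of _ _ _

/-! ## Derivations of the cup product -/

/-- A derivation of the cup product is a derivation of the bracket. -/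
theorem totBracket_derivation {k : ℤ} {δ : TotDpoly 𝒜 →ₗ[𝕜] TotDpoly 𝒜}
    (hdeg : ∀ i F, ∃ j G, (j.1 + j.2 : ℤ) = i.1 + i.2 + k ∧ δ (TotDpoly.of i F) = TotDpoly.of j G)
    (hder : ∀ x y, δ (totCup x y) = totCup (δ x) y + totCup (totSgn k x) (δ y))
    (x y : TotDpoly 𝒜) :
    δ (totBracket x y) = totBracket (δ x) y + totBracket (totSgn k x) (δ y) := by
  induction x using TotDpoly.induction with
  | zero => simp
  | add x x' hx hx' =>
    simp only [map_add, LinearMap.add_apply, hx, hx']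
    abel
  | of i F =>
    induction y using TotDpoly.induction with
    | zero => simp
    | add y y' hy hy' =>
      simp only [map_add, hy, hy']
      abel
    | of j G =>
      obtain ⟨i', F', hi, hF⟩ := hdeg i F
      obtain ⟨j', G', hj, hG⟩ := hdeg j G
      simp only [totBracket_of, totSgn_of, Units.smul_def, map_sub, map_zsmul, hder, hF, hG, hi,
        hj, LinearMap.smul_apply]
      rw [add_mul _ k, mul_add ((i.1 : ℤ) + i.2) _ k,
        mul_comm k ((i.1 : ℤ) + i.2), mul_comm k ((j.1 : ℤ) + j.2)]
      simp only [Int.negOnePow_add, Units.val_mul]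
      -- The signs depend only on the parities of |x|k, |y|k and |x||y|, which leaves eight cases.
      rcases Int.units_eq_one_or (((i.1 : ℤ) + i.2) * k).negOnePow with h | h <;>
      rcases Int.units_eq_one_or (((j.1 : ℤ) + j.2) * k).negOnePow with h' | h' <;>
      rcases Int.units_eq_one_or (((i.1 : ℤ) + i.2) * (j.1 + j.2)).negOnePow with h'' | h'' <;>
      · simp only [h, h', h'']
        simp
        try abel

theorem canConn_totCup {k : ℤ} {X : Module.End 𝕜 A} (hX : X ∈ VField 𝒜 k) (x y : TotDpoly 𝒜) :
    canConn (DirectSum.lof 𝕜 ℤ (fun k => VField 𝒜 k) k ⟨X, hX⟩) (totCup x y) =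
      totCup (canConn (DirectSum.lof 𝕜 ℤ (fun k => VField 𝒜 k) k ⟨X, hX⟩) x) y +
        totCup (totSgn k x) (canConn (DirectSum.lof 𝕜 ℤ (fun k => VField 𝒜 k) k ⟨X, hX⟩) y) := by
  induction x using TotDpoly.induction with
  | zero => simp
  | add x x' hx hx' =>
    simp only [map_add, LinearMap.add_apply, hx, hx']
    abel
  | of i F =>
    induction y using TotDpoly.induction with
    | zero => simp
    | add y y' hy hy' =>
      simp only [map_add, hy, hy']
      abel
    | of j G =>
      obtain ⟨p, r⟩ := i
      obtain ⟨q, s⟩ := j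
      obtain ⟨F, hF⟩ := F
      obtain ⟨G, hG⟩ := G
      dsimp only at F G hF hG
      have h1 := Dpoly.cup_mem rfl hF hG
      have h2 := Dpoly.field_comp hX h1
      have h3 : cup 𝒜 rfl (q + s) (fun f => X (F f)) G ∈ Dpoly 𝒜 (p + q) (r + s + k) := by
        have h := Dpoly.cup_mem rfl (Dpoly.field_comp hX hF) hG
        rwa [add_right_comm] at h
      have h4 : cup 𝒜 rfl (q + (s + k)) F (fun f => X (G f)) ∈ Dpoly 𝒜 (p + q) (r + s + k) := by
        have h := Dpoly.cup_mem rfl hF (Dpoly.field_comp hX hG)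
        rwa [← add_assoc r] at h
      rw [totCup_of rfl rfl hF hG h1, canConn_of hX, canConn_of hX, canConn_of hX,
        totCup_of rfl (add_right_comm r k s) (Dpoly.field_comp hX hF) hG h3, totSgn_of,
        Units.smul_def, map_zsmul, LinearMap.smul_apply, ← Units.smul_def,
        totCup_of rfl (add_assoc r s k).symm hF (Dpoly.field_comp hX hG) h4,
        TotDpoly.units_smul_of, TotDpoly.of_add]
      refine TotDpoly.of_congr rfl _ _ (funext fun f => ?_)
      rw [VField.apply_cup rfl hX hF, add_assoc]
      rfl

theorem canConn_totBracket {k : ℤ} {X : Module.End 𝕜 A} (hX : X ∈ VField 𝒜 k)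
    (x y : TotDpoly 𝒜) :
    canConn (DirectSum.lof 𝕜 ℤ (fun k => VField 𝒜 k) k ⟨X, hX⟩) (totBracket x y) =
      totBracket (canConn (DirectSum.lof 𝕜 ℤ (fun k => VField 𝒜 k) k ⟨X, hX⟩) x) y +
        totBracket (totSgn k x)
          (canConn (DirectSum.lof 𝕜 ℤ (fun k => VField 𝒜 k) k ⟨X, hX⟩) y) :=
  totBracket_derivation
    (fun i F => ⟨(i.1, i.2 + k), _, (add_assoc _ _ _).symm, canConn_of hX F.2⟩)
    (canConn_totCup hX) x y

/-! ### Right composition with cochains of total degree 2 -/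

/-- The right composition `F ↦ (-1)^{|F|} F ∘ E` with a cochain of total degree `2`. -/
def rightComp {r : ℕ} {s : ℤ} (E : Coch A (r + 1))
    (hE : ∀ {n : ℕ} {q : ℤ} {F : Coch A n}, F ∈ Dpoly 𝒜 n q →
      gerst 𝒜 (l := n + r) (n := n) rfl 2 F E ∈ Dpoly 𝒜 (n + r) (q + s)) :
    TotDpoly 𝒜 →ₗ[𝕜] TotDpoly 𝒜 :=
  -- This is the sign of F ∘ E in [E, F] when |E| = 2. It also turns right composition into a
  -- derivation acting from the left.
  TotDpoly.lift fun i => ((i.1 + i.2 : ℤ).negOnePow : ℤ) •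
    (TotDpoly.of (i.1 + r, i.2 + s) ∘ₗ
      { toFun := fun F => (⟨gerst 𝒜 (n := i.1) (m := r + 1) (l := i.1 + r) rfl 2 F.1 E, hE F.2⟩ : Dpoly 𝒜 (i.1 + r) (i.2 + s))
        map_add' := fun F G => Subtype.ext
          (gerst_add_left (𝒜 := 𝒜) (m := r + 1) (l := i.1 + r) rfl 2 F.1 G.1 E)
        map_smul' := fun c F => Subtype.ext
          (gerst_smul_left (𝒜 := 𝒜) (m := r + 1) (l := i.1 + r) rfl 2 c F.1 E) })

theorem rightComp_of {r : ℕ} {s : ℤ} (E : Coch A (r + 1))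
    (hE : ∀ {n : ℕ} {q : ℤ} {F : Coch A n}, F ∈ Dpoly 𝒜 n q →
      gerst 𝒜 (l := n + r) (n := n) rfl 2 F E ∈ Dpoly 𝒜 (n + r) (q + s)) {n : ℕ} {q : ℤ}
    {F : Coch A n} (hF : F ∈ Dpoly 𝒜 n q) :
    rightComp E hE (TotDpoly.of (n, q) ⟨F, hF⟩) =
      TotDpoly.of (n + r, q + s) ⟨(n + q : ℤ).negOnePow • gerst 𝒜 (n := n) (m := r + 1) (l := n + r) rfl 2 F E,
        Dpoly.units_smul_mem (hE hF) _⟩ := by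
  rw [rightComp, TotDpoly.lift_of, ← TotDpoly.units_smul_of (hE hF)]
  rfl

/-- The condition r + s = 1 says that E has total degree 2. In `gerst_cup_right` the sign (-1)^{|G|}
sits on (F ∘ E) ∪ G; multiplying by (-1)^{|F|+|G|} leaves (-1)^{|F|} there and moves (-1)^{|F|+|G|}
to F ∪ (G ∘ E), as the Leibniz rule requires. -/
theorem rightComp_totCup {r : ℕ} {s : ℤ} (hrs : r + s = 1) (E : Coch A (r + 1))
    (hE : ∀ {n : ℕ} {q : ℤ} {F : Coch A n}, F ∈ Dpoly 𝒜 n q →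
      gerst 𝒜 (l := n + r) (n := n) rfl 2 F E ∈ Dpoly 𝒜 (n + r) (q + s))
    (hE' : ∀ e f, koszul 𝒜 e (E f) = e.negOnePow • E fun i => koszul 𝒜 e (f i))
    (x y : TotDpoly 𝒜) :
    rightComp E hE (totCup x y) =
      totCup (rightComp E hE x) y + totCup (totSgn 1 x) (rightComp E hE y) := by
  induction x using TotDpoly.induction with
  | zero => simp
  | add x x' hx hx' =>
    simp only [map_add, LinearMap.add_apply, hx, hx']
    abel
  | of i F =>
    induction y using TotDpoly.induction with
    | zero => simp
    | add y y' hy hy' =>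
      simp only [map_add, hy, hy']
      abel
    | of j G =>
      obtain ⟨p, a⟩ := i
      obtain ⟨q, b⟩ := j
      obtain ⟨F, hF⟩ := F
      obtain ⟨G, hG⟩ := G
      dsimp only at F G hF hG
      have h1 := Dpoly.cup_mem rfl hF hG
      have hF' := Dpoly.units_smul_mem (hE hF) (p + a : ℤ).negOnePow
      have hG' := Dpoly.units_smul_mem (hE hG) (q + b : ℤ).negOnePow
      have h3 := Dpoly.cup_mem (Nat.add_right_comm p r q) hF' hG
      have h4 := Dpoly.cup_mem (Nat.add_assoc p q r).symm hF hG'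
      have h3' := h3
      have h4' := h4
      rw [add_right_comm a s b] at h3'
      rw [← add_assoc a b s] at h4'
      rw [totSgn_of, Units.smul_def, map_zsmul, LinearMap.smul_apply, ← Units.smul_def,
        totCup_of rfl rfl hF hG h1, rightComp_of, rightComp_of, rightComp_of,
        totCup_of (Nat.add_right_comm p r q) (add_right_comm a s b) hF' hG h3',
        totCup_of (Nat.add_assoc p q r).symm (add_assoc a b s).symm hF hG' h4',
        TotDpoly.units_smul_of, TotDpoly.of_add]
      refine TotDpoly.of_congr rfl _ _ (funext fun f => ?_)
      simp only [Pi.smul_apply, Pi.add_apply]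
      rw [gerst_cup_right hE' rfl _ rfl rfl (Nat.add_right_comm p r q) (Nat.add_assoc p q r).symm
        hF, show ((q + r : ℕ) + (b + s) : ℤ) = q + b + 1 by push_cast; rw [← hrs]; ring]
      simp only [cup, Pi.smul_apply, Units.smul_def, smul_add, smul_mul_assoc, mul_smul_comm]
      simp only [← Units.smul_def, smul_smul, ← Int.negOnePow_add]
      rw [add_comm]
      congr 2
      · rw [Int.negOnePow_eq_iff]
        exact ⟨q + b, by push_cast; ring⟩
      · congr 1
        push_cast
        ring

theorem rightComp_totBracket {r : ℕ} {s : ℤ} (hrs : r + s = 1) (E : Coch A (r + 1))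
    (hE : ∀ {n : ℕ} {q : ℤ} {F : Coch A n}, F ∈ Dpoly 𝒜 n q →
      gerst 𝒜 (l := n + r) (n := n) rfl 2 F E ∈ Dpoly 𝒜 (n + r) (q + s))
    (hE' : ∀ e f, koszul 𝒜 e (E f) = e.negOnePow • E fun i => koszul 𝒜 e (f i))
    (x y : TotDpoly 𝒜) :
    rightComp E hE (totBracket x y) =
      totBracket (rightComp E hE x) y + totBracket (totSgn 1 x) (rightComp E hE y) :=
  totBracket_derivation
    (fun i F => ⟨(i.1 + r, i.2 + s), _, by push_cast; rw [← hrs]; ring, rightComp_of E hE F.2⟩)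
    (rightComp_totCup hrs E hE hE') x y

/-- Inserting E into the arguments does not interact with applying X to the value. The sign only
records that ∇_X raises the total degree by k. -/
theorem canConn_rightComp {k : ℤ} {X : Module.End 𝕜 A} (hX : X ∈ VField 𝒜 k) {r : ℕ} {s : ℤ}
    (E : Coch A (r + 1))
    (hE : ∀ {n : ℕ} {q : ℤ} {F : Coch A n}, F ∈ Dpoly 𝒜 n q →
      gerst 𝒜 (l := n + r) (n := n) rfl 2 F E ∈ Dpoly 𝒜 (n + r) (q + s)) (x : TotDpoly 𝒜) :
    rightComp E hE (canConn (DirectSum.lof 𝕜 ℤ (fun k => VField 𝒜 k) k ⟨X, hX⟩) x) =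
      k.negOnePow • canConn (DirectSum.lof 𝕜 ℤ (fun k => VField 𝒜 k) k ⟨X, hX⟩)
        (rightComp E hE x) := by
  induction x using TotDpoly.induction with
  | zero => simp
  | add x x' hx hx' => simp only [map_add, hx, hx', smul_add]
  | of i F =>
    obtain ⟨n, q⟩ := i
    obtain ⟨F, hF⟩ := F
    rw [canConn_of, rightComp_of, rightComp_of, canConn_of, TotDpoly.units_smul_of]
    refine TotDpoly.of_congr (add_right_comm q k s) _ _ (funext fun f => ?_)
    simp only [gerst, Pi.smul_apply, Units.smul_def, map_zsmul, map_sum]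
    simp only [← Units.smul_def, smul_smul, ← Int.negOnePow_add]
    congr 2
    ring

/-! ## The differential -/

theorem isDiffOp_one_mem : (1 : Module.End 𝕜 A) ∈ DiffOp 𝒜 0 := isDiffOp_one

variable (𝒜) in
/-- The identity operator of `C^∞` as an element of `tot D_poly`. -/
def idBar : TotDpoly 𝒜 := TotDpoly.of (1, 0) ⟨coch 1, coch_mem isDiffOp_one_mem⟩

theorem gerst_mulCoch_mem {n : ℕ} {q : ℤ} {F : Coch A n} (hF : F ∈ Dpoly 𝒜 n q) :
    gerst 𝒜 (l := n + 1) (n := n) (m := 2) rfl 2 F (mulCoch 𝒜) ∈ Dpoly 𝒜 (n + 1) (q + 0) := by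
  rw [add_zero]
  exact Dpoly.comp_mulCoch rfl hF

/-- A cochain with n arguments and vertical degree q changes the shifted degree by q + 1 - n, which
is odd when n + q = 2. This and `koszul_apply_coch` supply the sign hypothesis of `rightComp_totCup`
for m and Q. -/
theorem koszul_apply_mulCoch (e : ℤ) (f : Fin 2 → A) :
    koszul 𝒜 e (mulCoch 𝒜 f) = e.negOnePow • mulCoch 𝒜 fun i => koszul 𝒜 e (f i) := by
  simp only [mulCoch, koszul_mulCoch, koszul_eq_sgn 1, Int.negOnePow_succ]
  simp

theorem koszul_apply_coch {Q : Module.End 𝕜 A} (hQ : Q ∈ VField 𝒜 1) (e : ℤ) (f : Fin 1 → A) :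
    koszul 𝒜 e (coch Q f) = e.negOnePow • coch Q fun i => koszul 𝒜 e (f i) := by
  simp only [coch, (IsDiffOp.field hQ).koszul_apply, mul_one]

theorem totLQ_of (Q : VField 𝒜 1) {n : ℕ} {q : ℤ} {F : Coch A n} (hF : F ∈ Dpoly 𝒜 n q)
    (h : gBracket 𝒜 (Nat.add_comm n 1) 2 (n + q) (coch Q.1) F ∈ Dpoly 𝒜 n (q + 1)) :
    totLQ Q (TotDpoly.of (n, q) ⟨F, hF⟩) =
      TotDpoly.of (n, q + 1) ⟨gBracket 𝒜 (Nat.add_comm n 1) 2 (n + q) (coch Q.1) F, h⟩ :=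
  TotDpoly.lift_of _ _ _

theorem totDH_of {n : ℕ} {q : ℤ} {F : Coch A n} (hF : F ∈ Dpoly 𝒜 n q)
    (h : gBracket 𝒜 (l := n + 1) (Nat.add_comm n 2) 2 (n + q) (mulCoch 𝒜) F ∈ Dpoly 𝒜 (n + 1) q) :
    totDH (TotDpoly.of (n, q) ⟨F, hF⟩) =
      TotDpoly.of (n + 1, q) ⟨gBracket 𝒜 (l := n + 1) (Nat.add_comm n 2) 2 (n + q) (mulCoch 𝒜) F,
        h⟩ :=
  TotDpoly.lift_of _ _ _

/-- Since -(-1)^{3(e+1)} = (-1)^e, the second term carries exactly the sign of `rightComp`. -/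
theorem gBracket_two {n m l : ℕ} (h : l + 1 = n + m) (e : ℤ) (F : Coch A n) (G : Coch A m) :
    gBracket 𝒜 h 2 e F G = gerst 𝒜 h e F G +
      e.negOnePow • gerst 𝒜 (h.trans (Nat.add_comm n m)) 2 G F := by
  rw [gBracket, sub_eq_add_neg, ← Units.neg_smul, ← Int.negOnePow_succ,
    (Int.negOnePow_eq_iff _ e).2 ⟨e + 2, by ring⟩]

theorem totLQ_eq (Q : VField 𝒜 1) (x : TotDpoly 𝒜) :
    totLQ Q x = canConn (DirectSum.lof 𝕜 ℤ (fun k => VField 𝒜 k) 1 Q) x +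
      rightComp (r := 0) (s := 1) (coch Q.1) (fun hF => Dpoly.comp_field rfl Q.2 hF) x := by
  induction x using TotDpoly.induction with
  | zero => simp
  | add x y hx hy =>
    simp only [map_add, hx, hy]
    abel
  | of i F =>
    obtain ⟨n, q⟩ := i
    obtain ⟨F, hF⟩ := F
    have h1 := Dpoly.field_comp Q.2 hF
    have h2 := Dpoly.units_smul_mem (Dpoly.comp_field rfl Q.2 hF) (n + q : ℤ).negOnePow
    have h3 : gBracket 𝒜 (Nat.add_comm n 1) 2 (n + q) (coch Q.1) F =
        (fun f => Q.1 (F f)) + (n + q : ℤ).negOnePow • gerst 𝒜 rfl 2 F (coch Q.1) := by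
      rw [gBracket_two, gerst_coch]
    rw [rightComp_of, canConn_of Q.2, totLQ_of Q hF (h3 ▸ add_mem h1 h2)]
    exact (TotDpoly.of_congr rfl _ (add_mem h1 h2) h3).trans (TotDpoly.of_add h1 h2).symm

/-- The product m ∘ F has two terms, F times the last argument and the first argument times F. Up to
sign these are F ∪ id and id ∪ F. -/
theorem totBracket_idBar {n : ℕ} {q : ℤ} {F : Coch A n} (hF : F ∈ Dpoly 𝒜 n q)
    (h : gerst 𝒜 (n := 2) (m := n) (l := n + 1) (Nat.add_comm n 2) (n + q) (mulCoch 𝒜) F ∈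
      Dpoly 𝒜 (n + 1) q) :
    totBracket (idBar 𝒜) (TotDpoly.of (n, q) ⟨F, hF⟩) = -TotDpoly.of (n + 1, q)
      ⟨gerst 𝒜 (n := 2) (m := n) (l := n + 1) (Nat.add_comm n 2) (n + q) (mulCoch 𝒜) F, h⟩ := by
  have h1 : coch (1 : Module.End 𝕜 A) ∈ Dpoly 𝒜 1 0 := coch_mem isDiffOp_one_mem
  have h2 := Dpoly.cup_mem (l := n + 1) (Nat.add_comm 1 n) h1 hF
  have h3 := Dpoly.cup_mem (l := n + 1) rfl hF h1
  have h2' := h2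
  have h3' := h3
  rw [zero_add] at h2'
  rw [add_zero] at h3'
  rw [idBar, totBracket_of, totCup_of (Nat.add_comm 1 n) (zero_add q) h1 hF h2',
    totCup_of rfl (add_zero q) hF h1 h3', TotDpoly.units_smul_of, TotDpoly.neg_of, TotDpoly.of_sub]
  refine TotDpoly.of_congr rfl _ _ (funext fun f => ?_)
  simp only [Pi.sub_apply, Pi.neg_apply, Pi.smul_apply, gerst_mulCoch, sgn_one_koszul]
  simp only [cup, coch, Dpoly.sgn_apply hF, Nat.cast_one, add_zero, one_mul, Module.End.one_apply,
    Units.smul_def, smul_mul_assoc, neg_mul, neg_add, neg_neg]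
  rw [sub_eq_add_neg, add_comm]
  rfl

theorem totDH_eq (x : TotDpoly 𝒜) :
    totDH x = -totBracket (idBar 𝒜) x + rightComp (r := 1) (mulCoch 𝒜) gerst_mulCoch_mem x := by
  induction x using TotDpoly.induction with
  | zero => simp
  | add x y hx hy =>
    simp only [map_add, hx, hy]
    abel
  | of i F =>
    obtain ⟨n, q⟩ := i
    obtain ⟨F, hF⟩ := F
    have h1 := Dpoly.mulCoch_comp (Nat.add_comm n 2) hF
    have h2 := Dpoly.units_smul_mem (Dpoly.comp_mulCoch rfl hF) (n + q : ℤ).negOnePow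
    have h3 := gBracket_two (𝒜 := 𝒜) (l := n + 1) (Nat.add_comm n 2) (n + q) (mulCoch 𝒜) F
    rw [rightComp_of, totBracket_idBar hF h1, neg_neg, totDH_of hF (h3 ▸ add_mem h1 h2),
      TotDpoly.of_congr (add_zero q) _ h2 rfl]
    exact (TotDpoly.of_congr rfl _ (add_mem h1 h2) h3).trans (TotDpoly.of_add h1 h2).symm

/-! ### Flatness of the connection and the Atiyah cocycle -/

theorem canConn_idBar {k : ℤ} {X : Module.End 𝕜 A} (hX : X ∈ VField 𝒜 k) :
    canConn (DirectSum.lof 𝕜 ℤ (fun k => VField 𝒜 k) k ⟨X, hX⟩) (idBar 𝒜) =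
      fieldBar (DirectSum.lof 𝕜 ℤ (fun k => VField 𝒜 k) k ⟨X, hX⟩) := by
  rw [idBar, canConn_of, fieldBar_lof]
  exact TotDpoly.of_congr (zero_add k) _ _ rfl

/-- Flatness in the direction of Q: the connection is composition of operators, so it takes graded
commutators to graded commutators. -/
theorem canConn_adQ (Q : VField 𝒜 1) {k : ℤ} (X : VField 𝒜 k) (x : TotDpoly 𝒜) :
    canConn (DirectSum.lof 𝕜 ℤ (fun k => VField 𝒜 k) (k + 1) (adQ Q k X)) x =
      canConn (DirectSum.lof 𝕜 ℤ (fun k => VField 𝒜 k) 1 Q)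
          (canConn (DirectSum.lof 𝕜 ℤ (fun k => VField 𝒜 k) k X) x) -
        k.negOnePow • canConn (DirectSum.lof 𝕜 ℤ (fun k => VField 𝒜 k) k X)
          (canConn (DirectSum.lof 𝕜 ℤ (fun k => VField 𝒜 k) 1 Q) x) := by
  induction x using TotDpoly.induction with
  | zero => simp
  | add x y hx hy =>
    simp only [map_add, hx, hy, smul_add]
    abel
  | of i F =>
    obtain ⟨n, q⟩ := i
    obtain ⟨F, hF⟩ := F
    obtain ⟨Q, hQ⟩ := Q
    obtain ⟨X, hX⟩ := X
    have h1 := Dpoly.field_comp hQ (Dpoly.field_comp hX hF)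
    have h2 := Dpoly.field_comp hX (Dpoly.field_comp hQ hF)
    have h1' := h1
    have h2' := h2
    rw [add_assoc] at h1'
    rw [add_assoc, add_comm 1 k] at h2'
    rw [canConn_of hX, canConn_of hQ, canConn_of hQ, canConn_of hX,
      TotDpoly.of_congr (add_assoc q k 1) _ h1' rfl,
      TotDpoly.of_congr ((add_assoc q 1 k).trans (by rw [add_comm 1 k])) _ h2' rfl,
      TotDpoly.units_smul_of, TotDpoly.of_sub]
    refine (canConn_of (adQ ⟨Q, hQ⟩ k ⟨X, hX⟩).2 hF).trans ?_
    refine TotDpoly.of_congr rfl _ _ (funext fun f => ?_)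
    rfl

/-- The Atiyah cocycle of `tot D_poly` with respect to the canonical connection. -/
theorem atiyahCocycle_canConn (Q : VField 𝒜 1) (X : VectorFields 𝒜) (x : TotDpoly 𝒜) :
    atiyahCocycle Q (totD Q) canConn X x = totBracket (fieldBar X) x := by
  induction X using DirectSum.induction_on with
  | zero => simp
  | add X Y hX hY => simp only [map_add, LinearMap.add_apply, hX, hY]
  | of k X =>
    change atiyahCocycle Q (totD Q) canConn (DirectSum.lof 𝕜 ℤ (fun k => VField 𝒜 k) k X) x =
      totBracket (fieldBar (DirectSum.lof 𝕜 ℤ (fun k => VField 𝒜 k) k X)) x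
    obtain ⟨X, hX⟩ := X
    -- The source of the answer: ∇_X id = X̄, and |id| = 1 turns the twist into (-1)^k.
    have h := canConn_totBracket hX (idBar 𝒜) x
    rw [canConn_idBar, idBar, totSgn_of, ← idBar] at h
    rw [atiyahCocycle, DirectSum.toModule_lof, LinearMap.mk₂_apply, canConn_adQ]
    simp only [totD, LinearMap.add_apply, totLQ_eq, totDH_eq, canConn_rightComp, map_add, map_neg,
      h, Units.smul_def, map_zsmul, LinearMap.smul_apply]
    simp only [← Units.smul_def]
    -- For either sign, the terms with ∇_Q, with the right compositions and with ⟦id, ∇_X x⟧ cancel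
    -- in pairs.
    rcases Int.units_eq_one_or k.negOnePow with h' | h' <;>
    · simp [h']
      try abel

/-! ## The free Lie algebra -/

/-- Minimality used as an induction principle. Homogeneous generators suffice because S is a
subspace. -/
theorem freeLie_le {S : Submodule 𝕜 (TotDpoly 𝒜)}
    (hbar : ∀ {d : ℤ} {D : Module.End 𝕜 A} (hD : D ∈ DiffOp 𝒜 d),
      TotDpoly.of (1, d) ⟨coch D, coch_mem hD⟩ ∈ S)
    (hS : ∀ x ∈ S, ∀ y ∈ S, totBracket x y ∈ S) : freeLie 𝒜 ≤ S := by
  refine sInf_le ⟨?_, hS⟩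
  rintro _ ⟨D, rfl⟩
  induction D using DirectSum.induction_on with
  | zero => simp
  | add D E hD hE =>
    rw [map_add]
    exact add_mem hD hE
  | of d D =>
    have h := hbar D.2
    rwa [← bar_lof] at h

theorem of_coch_mem_freeLie {d : ℤ} {D : Module.End 𝕜 A} (hD : D ∈ DiffOp 𝒜 d) :
    TotDpoly.of (1, d) ⟨coch D, coch_mem hD⟩ ∈ freeLie 𝒜 :=
  Submodule.mem_sInf.2 fun _ hS => hS.1 ⟨_, bar_lof hD⟩

theorem totBracket_mem_freeLie {x y : TotDpoly 𝒜} (hx : x ∈ freeLie 𝒜) (hy : y ∈ freeLie 𝒜) :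
    totBracket x y ∈ freeLie 𝒜 :=
  Submodule.mem_sInf.2 fun S hS =>
    hS.2 _ (Submodule.mem_sInf.1 hx S hS) _ (Submodule.mem_sInf.1 hy S hS)

theorem units_smul_mem_freeLie {x : TotDpoly 𝒜} (hx : x ∈ freeLie 𝒜) (ε : ℤˣ) :
    ε • x ∈ freeLie 𝒜 :=
  zsmul_mem hx ε

theorem totSgn_totBracket (k : ℤ) (x y : TotDpoly 𝒜) :
    totSgn k (totBracket x y) = totBracket (totSgn k x) (totSgn k y) := by
  induction x using TotDpoly.induction with
  | zero => simp
  | add x x' hx hx' => simp only [map_add, LinearMap.add_apply, hx, hx']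
  | of i F =>
    induction y using TotDpoly.induction with
    | zero => simp
    | add y y' hy hy' => simp only [map_add, hy, hy']
    | of j G =>
      obtain ⟨p, r⟩ := i
      obtain ⟨q, s⟩ := j
      obtain ⟨F, hF⟩ := F
      obtain ⟨G, hG⟩ := G
      have h1 := Dpoly.cup_mem rfl hF hG
      have h2 := Dpoly.cup_mem rfl hG hF
      rw [totSgn_of k (p, r), totSgn_of k (q, s), totBracket_of, totCup_of rfl rfl hF hG h1,
        totCup_of rfl rfl hG hF h2]
      simp only [map_sub, Units.smul_def, map_zsmul, LinearMap.smul_apply]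
      rw [totBracket_of, totCup_of rfl rfl hF hG h1, totCup_of rfl rfl hG hF h2,
        totSgn_of k (p + q, r + s), totSgn_of k (q + p, s + r)]
      simp only [← Units.smul_def, smul_sub, smul_smul, ← Int.negOnePow_add]
      congr 3 <;>
      · push_cast
        ring

/-- Generators are homogeneous and total degrees add under the bracket. This is needed because the
Leibniz rule of a derivation of degree k twists its first argument. -/
theorem totSgn_mem_freeLie (k : ℤ) {x : TotDpoly 𝒜} (hx : x ∈ freeLie 𝒜) :
    totSgn k x ∈ freeLie 𝒜 := by
  refine (freeLie_le (S := (freeLie 𝒜).comap (totSgn k)) ?_ ?_) hx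
  · intro d D hD
    rw [Submodule.mem_comap, totSgn_of]
    exact units_smul_mem_freeLie (of_coch_mem_freeLie hD) _
  · intro x hx y hy
    rw [Submodule.mem_comap, totSgn_totBracket]
    exact totBracket_mem_freeLie hx hy

/-- A derivation of the bracket that maps the generators of the free Lie algebra to its elements
preserves it. -/
theorem freeLie_derivation {k : ℤ} {δ : TotDpoly 𝒜 →ₗ[𝕜] TotDpoly 𝒜}
    (hδ : ∀ x y, δ (totBracket x y) = totBracket (δ x) y + totBracket (totSgn k x) (δ y))
    (hbar : ∀ {d : ℤ} {D : Module.End 𝕜 A} (hD : D ∈ DiffOp 𝒜 d),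
      δ (TotDpoly.of (1, d) ⟨coch D, coch_mem hD⟩) ∈ freeLie 𝒜)
    {x : TotDpoly 𝒜} (hx : x ∈ freeLie 𝒜) : δ x ∈ freeLie 𝒜 := by
  -- The intersection keeps x and y themselves in the free Lie algebra, as the two terms of the
  -- Leibniz rule require.
  refine ((freeLie_le (S := freeLie 𝒜 ⊓ (freeLie 𝒜).comap δ) ?_ ?_) hx).2
  · exact fun hD => ⟨of_coch_mem_freeLie hD, hbar hD⟩
  · rintro x ⟨hx, hx'⟩ y ⟨hy, hy'⟩
    refine ⟨totBracket_mem_freeLie hx hy, ?_⟩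
    change δ _ ∈ freeLie 𝒜
    rw [hδ]
    exact add_mem (totBracket_mem_freeLie hx' hy)
      (totBracket_mem_freeLie (totSgn_mem_freeLie k hx) hy')

/-! ### Left composition with differential operators -/

/-- The left composition `F ↦ D ∘ F` with a differential operator. -/
def leftComp {d : ℤ} {D : Module.End 𝕜 A} (hD : IsDiffOp 𝒜 d D) : TotDpoly 𝒜 →ₗ[𝕜] TotDpoly 𝒜 :=
  TotDpoly.lift fun i => TotDpoly.of (i.1, i.2 + d) ∘ₗ
    { toFun := fun F => (⟨fun f => D (F.1 f), Dpoly.diffOp_comp hD F.2⟩ : Dpoly 𝒜 i.1 (i.2 + d))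
      map_add' := fun F G => Subtype.ext (funext fun f => map_add D (F.1 f) (G.1 f))
      map_smul' := fun c F => Subtype.ext (funext fun f => map_smul D c (F.1 f)) }

theorem leftComp_of {d : ℤ} {D : Module.End 𝕜 A} (hD : IsDiffOp 𝒜 d D) {n : ℕ} {q : ℤ}
    {F : Coch A n} (hF : F ∈ Dpoly 𝒜 n q) :
    leftComp hD (TotDpoly.of (n, q) ⟨F, hF⟩) =
      TotDpoly.of (n, q + d) ⟨fun f => D (F f), Dpoly.diffOp_comp hD hF⟩ :=
  TotDpoly.lift_of _ _ _

theorem leftComp_field {k : ℤ} {X : Module.End 𝕜 A} (hX : X ∈ VField 𝒜 k) :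
    leftComp (IsDiffOp.field hX) =
      canConn (DirectSum.lof 𝕜 ℤ (fun k => VField 𝒜 k) k ⟨X, hX⟩) := by
  ext x
  induction x using TotDpoly.induction with
  | zero => simp
  | add x y hx hy => simp only [map_add, hx, hy]
  | of i F => exact (leftComp_of _ F.2).trans (canConn_of hX F.2).symm

theorem leftComp_comp {d e : ℤ} {D E : Module.End 𝕜 A} (hD : IsDiffOp 𝒜 d D)
    (hE : IsDiffOp 𝒜 e E) (x : TotDpoly 𝒜) :
    leftComp (hD.comp hE) x = leftComp hD (leftComp hE x) := by
  induction x using TotDpoly.induction with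
  | zero => simp
  | add x y hx hy => simp only [map_add, hx, hy]
  | of i F =>
    obtain ⟨n, q⟩ := i
    obtain ⟨F, hF⟩ := F
    rw [leftComp_of, leftComp_of, leftComp_of]
    exact TotDpoly.of_congr (by ring) _ _ rfl

theorem leftComp_add {d : ℤ} {D E : Module.End 𝕜 A} (hD : IsDiffOp 𝒜 d D)
    (hE : IsDiffOp 𝒜 d E) (x : TotDpoly 𝒜) :
    leftComp (hD.add hE) x = leftComp hD x + leftComp hE x := by
  induction x using TotDpoly.induction with
  | zero => simp
  | add x y hx hy =>
    simp only [map_add, hx, hy]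
    abel
  | of i F =>
    obtain ⟨n, q⟩ := i
    obtain ⟨F, hF⟩ := F
    rw [leftComp_of, leftComp_of, leftComp_of, TotDpoly.of_add]
    rfl

theorem leftComp_of_coch {d e : ℤ} {D E : Module.End 𝕜 A} (hD : IsDiffOp 𝒜 d D)
    (hE : E ∈ DiffOp 𝒜 e) :
    leftComp hD (TotDpoly.of (1, e) ⟨coch E, coch_mem hE⟩) ∈ freeLie 𝒜 := by
  have h := of_coch_mem_freeLie (hD.comp hE)
  rw [TotDpoly.of_congr (F := coch (D * E)) (add_comm d e) _ (Dpoly.diffOp_comp hD (coch_mem hE)) rfl] at h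
  rwa [leftComp_of]

/-- For a graded commutative algebra, the bracket is linear over functions in its first
argument. -/
theorem leftComp_mul_totBracket
    (hcomm : ∀ i j, ∀ a ∈ 𝒜 i, ∀ b ∈ 𝒜 j, a * b = (i * j).negOnePow • (b * a))
    {i : ℤ} {a : A} (ha : a ∈ 𝒜 i) (x y : TotDpoly 𝒜) :
    leftComp (IsDiffOp.mul ha) (totBracket x y) =
      totBracket (leftComp (IsDiffOp.mul ha) x) y := by
  induction x using TotDpoly.induction with
  | zero => simp
  | add x x' hx hx' => simp only [map_add, LinearMap.add_apply, hx, hx']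
  | of j F =>
    induction y using TotDpoly.induction with
    | zero => simp
    | add y y' hy hy' => simp only [map_add, hy, hy']
    | of l G =>
      obtain ⟨p, r⟩ := j
      obtain ⟨q, s⟩ := l
      obtain ⟨F, hF⟩ := F
      obtain ⟨G, hG⟩ := G
      dsimp only at F G hF hG
      have hF' := Dpoly.diffOp_comp (IsDiffOp.mul ha) hF
      have h1 := Dpoly.cup_mem rfl hF hG
      have h2 := Dpoly.cup_mem (Nat.add_comm q p) hG hF
      have h3 := Dpoly.cup_mem rfl hF' hG
      have h4 := Dpoly.cup_mem (Nat.add_comm q p) hG hF'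
      have h2' := h2
      have h3' := h3
      have h4' := h4
      rw [add_comm s r] at h2'
      rw [add_right_comm r i s] at h3'
      rw [← add_assoc s, add_comm s r] at h4'
      rw [leftComp_of, totBracket_of, totBracket_of, totCup_of rfl rfl hF hG h1,
        totCup_of (Nat.add_comm q p) (add_comm s r) hG hF h2',
        totCup_of rfl (add_right_comm r i s) hF' hG h3',
        totCup_of (Nat.add_comm q p) (t := r + s + i) (by ring) hG hF' h4',
        Units.smul_def, map_sub, map_zsmul, leftComp_of, leftComp_of, ← Units.smul_def,
        TotDpoly.units_smul_of, TotDpoly.units_smul_of, ← map_sub, ← map_sub]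
      refine TotDpoly.of_congr rfl _ _ (funext fun f => ?_)
      -- In x ∪ y the function already stands next to x. In y ∪ x it must pass y, and the resulting
      -- sign i|y| turns |x||y| into (|x| + i)|y|.
      simp only [Pi.sub_apply, Pi.smul_apply, LinearMap.mulLeft_apply, mul_cup hcomm _ ha hG]
      congr 1
      · simp only [cup, mul_assoc]
      · rw [smul_smul, ← Int.negOnePow_add, ← add_assoc]
        congr 2
        ring

/-- A general D is not a derivation of the bracket, so the induction follows the generation of D:
functions act linearly on the first argument of the bracket, vector fields act by derivations, and
products and sums follow. -/
theorem leftComp_mem_freeLie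
    (hcomm : ∀ i j, ∀ a ∈ 𝒜 i, ∀ b ∈ 𝒜 j, a * b = (i * j).negOnePow • (b * a))
    {d : ℤ} {D : Module.End 𝕜 A} (hD : IsDiffOp 𝒜 d D) {x : TotDpoly 𝒜} (hx : x ∈ freeLie 𝒜) :
    leftComp hD x ∈ freeLie 𝒜 := by
  induction hD generalizing x with
  | mul ha =>
    refine ((freeLie_le (S := freeLie 𝒜 ⊓ (freeLie 𝒜).comap (leftComp (IsDiffOp.mul ha))) ?_ ?_)
      hx).2
    · exact fun hE => ⟨of_coch_mem_freeLie hE, leftComp_of_coch _ hE⟩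
    · rintro x ⟨hx, hx'⟩ y ⟨hy, hy'⟩
      refine ⟨totBracket_mem_freeLie hx hy, ?_⟩
      change leftComp (IsDiffOp.mul ha) _ ∈ freeLie 𝒜
      rw [leftComp_mul_totBracket hcomm ha]
      exact totBracket_mem_freeLie hx' hy
  | @field k _ hX =>
    refine freeLie_derivation (k := k) ?_ (fun hE => leftComp_of_coch _ hE) hx
    rw [leftComp_field]
    exact canConn_totBracket hX
  | comp hD hE hD' hE' =>
    rw [leftComp_comp hD hE]
    exact hD' (hE' hx)
  | add hD hE hD' hE' =>
    rw [leftComp_add hD hE]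
    exact add_mem (hD' hx) (hE' hx)

theorem canConn_mem_freeLie
    (hcomm : ∀ i j, ∀ a ∈ 𝒜 i, ∀ b ∈ 𝒜 j, a * b = (i * j).negOnePow • (b * a))
    (X : VectorFields 𝒜) {x : TotDpoly 𝒜} (hx : x ∈ freeLie 𝒜) : canConn X x ∈ freeLie 𝒜 := by
  induction X using DirectSum.induction_on with
  | zero => simp
  | add X Y hX hY =>
    rw [map_add, LinearMap.add_apply]
    exact add_mem hX hY
  | of k X =>
    have h := leftComp_mem_freeLie hcomm (IsDiffOp.field X.2) hx
    rwa [leftComp_field] at h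

/-! ### Stability of the free Lie algebra under the differential -/

theorem mulCoch_mem : mulCoch 𝒜 ∈ Dpoly 𝒜 2 0 := by
  -- Here m is written as id ∘ m.
  have h := Dpoly.comp_mulCoch rfl (coch_mem (𝒜 := 𝒜) isDiffOp_one_mem)
  convert h using 1
  funext f
  simp [gerst, coch]

/-- As id has odd total degree, its bracket with itself does not vanish: ⟦id, id⟧ = -2m, and 2 is
invertible. -/
theorem of_mulCoch_mem_freeLie [NeZero (2 : 𝕜)] :
    TotDpoly.of (2, 0) ⟨mulCoch 𝒜, mulCoch_mem⟩ ∈ freeLie 𝒜 := by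
  have h1 := of_coch_mem_freeLie (𝒜 := 𝒜) isDiffOp_one_mem
  have h2 := totBracket_mem_freeLie h1 h1
  have h3 : totBracket (idBar 𝒜) (idBar 𝒜) =
      (-2 : 𝕜) • TotDpoly.of (2, 0) ⟨mulCoch 𝒜, mulCoch_mem⟩ := by
    refine (totBracket_idBar _ (Dpoly.mulCoch_comp _ (coch_mem isDiffOp_one_mem))).trans ?_
    rw [TotDpoly.neg_of, TotDpoly.smul_of]
    refine TotDpoly.of_congr rfl _ _ (funext fun f => ?_)
    rw [Pi.neg_apply, gerst_mulCoch, Nat.cast_one, add_zero, show (1 + 1 : ℤ) = 0 + 2 by norm_num,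
      koszul_add_two, koszul_zero]
    simp [coch, mulCoch, two_smul]
  change totBracket (idBar 𝒜) (idBar 𝒜) ∈ freeLie 𝒜 at h2
  rw [h3] at h2
  exact (Submodule.smul_mem_iff _ (neg_ne_zero.2 two_ne_zero)).1 h2

theorem totD_mem_freeLie [NeZero (2 : 𝕜)]
    (hcomm : ∀ i j, ∀ a ∈ 𝒜 i, ∀ b ∈ 𝒜 j, a * b = (i * j).negOnePow • (b * a))
    (Q : VField 𝒜 1) {x : TotDpoly 𝒜} (hx : x ∈ freeLie 𝒜) : totD Q x ∈ freeLie 𝒜 := by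
  rw [totD, LinearMap.add_apply, totLQ_eq, totDH_eq]
  -- The summands are ∇_Q, R_Q, -⟦id, ·⟧ and R_m.
  refine add_mem (add_mem (canConn_mem_freeLie hcomm _ hx) ?_) (add_mem (neg_mem ?_) ?_)
  · refine freeLie_derivation (rightComp_totBracket (by norm_num) _ _ (koszul_apply_coch Q.2)) ?_ hx
    intro d D hD
    rw [rightComp_of, ← TotDpoly.units_smul_of (Dpoly.comp_field rfl Q.2 (coch_mem hD))]
    refine units_smul_mem_freeLie ?_ _
    have h := of_coch_mem_freeLie (IsDiffOp.comp hD (IsDiffOp.field Q.2))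
    rwa [TotDpoly.of_congr rfl _ (Dpoly.comp_field rfl Q.2 (coch_mem hD))
      (funext fun f => by simp [gerst, coch])] at h
  · exact totBracket_mem_freeLie (of_coch_mem_freeLie isDiffOp_one_mem) hx
  · refine freeLie_derivation (rightComp_totBracket (by norm_num) _ _ koszul_apply_mulCoch) ?_ hx
    intro d D hD
    rw [rightComp_of, ← TotDpoly.units_smul_of (gerst_mulCoch_mem (coch_mem hD))]
    refine units_smul_mem_freeLie ?_ _
    -- On a generator, right composition with m equals left composition of D with m, which is an
    -- element of the free Lie algebra.
    have h := leftComp_mem_freeLie hcomm hD of_mulCoch_mem_freeLie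
    have h' := leftComp_of hD (mulCoch_mem (𝒜 := 𝒜))
    rw [h', TotDpoly.of_congr (add_comm 0 d) _ (gerst_mulCoch_mem (coch_mem hD))
      (funext fun f => by simp [gerst, coch])] at h
    exact h

end Algebra

/-! ### Restriction of the Atiyah cocycle to an invariant subspace -/

section Restriction

variable {𝕜 : Type u} [Field 𝕜] {A : Type v} [Ring A] [Algebra 𝕜 A]
variable {𝒜 : ℤ → Submodule 𝕜 A}

/-- The Atiyah cocycle of an invariant subspace is the restriction of the Atiyah cocycle. -/
theorem coe_atiyahCocycle_restrict (Q : VField 𝒜 1) {N : Type*} [AddCommGroup N] [Module 𝕜 N]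
    (d : N →ₗ[𝕜] N) (conn : VectorFields 𝒜 →ₗ[𝕜] N →ₗ[𝕜] N) (L : Submodule 𝕜 N)
    (hd : ∀ x ∈ L, d x ∈ L) (hc : ∀ X, ∀ x ∈ L, conn X x ∈ L) (X : VectorFields 𝒜) (x : L) :
    (atiyahCocycle Q (d.restrict hd) (restrictConn L conn hc) X x : N) =
      atiyahCocycle Q d conn X x := by
  induction X using DirectSum.induction_on with
  | zero => simp
  | add X Y hX hY =>
    simp only [map_add, LinearMap.add_apply, Submodule.coe_add, hX, hY]
  | of k X =>
    change (atiyahCocycle Q (d.restrict hd) (restrictConn L conn hc)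
      (DirectSum.lof 𝕜 ℤ (fun k => VField 𝒜 k) k X) x : N) =
        atiyahCocycle Q d conn (DirectSum.lof 𝕜 ℤ (fun k => VField 𝒜 k) k X) x
    rw [atiyahCocycle, atiyahCocycle, DirectSum.toModule_lof, DirectSum.toModule_lof,
      LinearMap.mk₂_apply, LinearMap.mk₂_apply]
    rfl

end Restriction

theorem mainTheorem6 {𝕜 : Type u} [RCLike 𝕜] {n : ℕ} {M : Type v} [TopologicalSpace M] [T2Space M]
    [SecondCountableTopology M] [ChartedSpace (EuclideanSpace ℝ (Fin n)) M]
    [IsManifold (modelWithCornersSelf ℝ (EuclideanSpace ℝ (Fin n))) ∞ M]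
    (𝓜 : DGManifold.{u, v, w} 𝕜 n M) :
    (∀ (X : VectorFields 𝓜.functions) (D : List (DiffOps 𝓜.functions)),
      atiyahCocycle 𝓜.Q (totD 𝓜.Q) canConn X (cupList (D.map bar)) =
        totBracket (fieldBar X) (cupList (D.map bar))) ∧
    ∃ (hd : ∀ x ∈ freeLie 𝓜.functions, totD 𝓜.Q x ∈ freeLie 𝓜.functions)
      (hc : ∀ (X : VectorFields 𝓜.functions), ∀ x ∈ freeLie 𝓜.functions,
        canConn X x ∈ freeLie 𝓜.functions),
      ∀ (X : VectorFields 𝓜.functions) (D : DiffOps 𝓜.functions) (l : List (DiffOps 𝓜.functions)),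
        (atiyahCocycle 𝓜.Q ((totD 𝓜.Q).restrict hd)
          (restrictConn (freeLie 𝓜.functions) canConn hc) X
          ⟨nestedBracket (bar D) (l.map bar), nestedBracket_mem D l⟩ : TotDpoly 𝓜.functions) =
        totBracket (fieldBar X) (nestedBracket (bar D) (l.map bar)) := by
  -- The formula is known for arbitrary elements, so neither half needs an induction on n.
  refine ⟨fun X D => atiyahCocycle_canConn 𝓜.Q X _,
    fun x hx => totD_mem_freeLie (𝓜.graded_comm ⊤) 𝓜.Q hx,
    fun X x hx => canConn_mem_freeLie (𝓜.graded_comm ⊤) X hx, fun X D l => ?_⟩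
  rw [coe_atiyahCocycle_restrict, atiyahCocycle_canConn]
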